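/- For an open set $\Omega\subseteq\mathbb C$ let $K_\Omega(z,w)=\sum_i\varphi_i(z)\overline{\varphi_i(w)}$ be its Bergman kernel, where $(\varphi_i)$ is an orthonormal basis of the Hilbert space $L^2\cap\mathcal O(\Omega)$ of holomorphic functions on $\Omega$ that are square integrable for Lebesgue measure. For a bounded domain $\Omega$, the Bergman length of a vector $X\in\mathbb C$ at $z\in\Omega$ is $\beta_\Omega(z,X)=\bigl(\tfrac{\partial^2}{\partial z\,\partial\bar z}\log K_\Omega(z,z)\bigr)^{1/2}|X|$, and $\mathrm{dist}_\Omega(z,w)$ is the infimum of $\int_0^1\beta_\Omega(\gamma(t),\gamma'(t))\,dt$ over all piecewise $C^1$ curves $\gamma:[0,1]\to\Omega$ from $z$ to $w$. For $0<r<1$ let $P_r=\{z\in\mathbb C: r<|z|<1\}$. (a) For every $\varepsilon>0$ there is $r_0\in(0,1)$ such that for every $r\in(0,r_0)$ there exists a point $z_0\in P_r$ for which $z\mapsto K_{P_r}(z,z_0)$ has a zero in the geodesic ball $\{z\in P_r:\mathrm{dist}_{P_r}(z,z_0)<\tfrac{\pi}{2}+\varepsilon\}$. In particular, for every $\varepsilon>0$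 there are a bounded domain $\Omega_\varepsilon$ and a point $z_0\in\Omega_\varepsilon$ such that $K_{\Omega_\varepsilon}(\cdot,z_0)$ has a zero in the Bergman geodesic ball of radius $\tfrac{\pi}{2}+\varepsilon$ around $z_0$. (b) Consequently, for no $R>\tfrac{\pi}{2}$ is it true that for every bounded domain $\Omega\subset\mathbb C$ and every $z_0\in\Omega$ the function $K_\Omega(\cdot,z_0)$ is zero-free in $\{z\in\Omega:\mathrm{dist}_\Omega(z,z_0)<R\}$. That is, the radius $\tfrac{\pi}{2}$ in the theorem that $K_\Omega(\cdot,z_0)$ never vanishes in the geodesic ball of radius $\tfrac{\pi}{2}$ around $z_0$ cannot be increased. -/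

import Mathlib

open MeasureTheory Filter Topology Metric
open scoped ENNReal Real

/-! ### The Bergman space `L² ∩ 𝒪(Ω)` as a closed subspace of `L²(Ω)` -/

theorem Bergman.circle_bound {g : ℂ → ℂ} {c : ℂ} {R ρ : ℝ}
    (hg : DifferentiableOn ℂ g (ball c R)) (h0 : 0 < ρ) (hρ : ρ < R) :
    ENNReal.ofReal (2 * π) * ‖g c‖ₑ ≤
      ∫⁻ θ in Set.Ioo (-π) π, ‖g (circleMap c ρ θ)‖ₑ := by
  have hd : DiffContOnCl ℂ g (ball c |ρ|) := by
    apply DifferentiableOn.diffContOnCl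
    rw [abs_of_pos h0]
    exact hg.mono (closure_ball_subset_closedBall.trans (closedBall_subset_ball hρ))
  have hav := hd.circleAverage
  rw [Real.circleAverage_def] at hav
  have hper : ∫ θ in (0 : ℝ)..2 * π, g (circleMap c ρ θ) =
      ∫ θ in (-π)..π, g (circleMap c ρ θ) := by
    have hp : Function.Periodic (fun θ => g (circleMap c ρ θ)) (2 * π) := fun θ => by
      simp only [periodic_circleMap c ρ θ]
    have := hp.intervalIntegral_add_eq 0 (-π)
    rw [zero_add] at this
    rw [this]
    congr 1
    ring
  have hpi : (0 : ℝ) < 2 * π := by positivity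
  have heq : (2 * π : ℝ) • g c = ∫ θ in Set.Ioo (-π) π, g (circleMap c ρ θ) := by
    rw [← hav, smul_smul, mul_inv_cancel₀ hpi.ne', one_smul, hper,
      intervalIntegral.integral_of_le (by linarith [Real.pi_pos]), integral_Ioc_eq_integral_Ioo]
  calc ENNReal.ofReal (2 * π) * ‖g c‖ₑ = ‖(2 * π : ℝ) • g c‖ₑ := by
        rw [enorm_smul, Real.enorm_eq_ofReal hpi.le]
    _ ≤ _ := by
        rw [heq]
        exact enorm_integral_le_lintegral_enorm _

theorem Bergman.ball_bound {g : ℂ → ℂ} {c : ℂ} {R : ℝ} (hR : 0 < R)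
    (hg : DifferentiableOn ℂ g (ball c R)) :
    ENNReal.ofReal (π * R ^ 2) * ‖g c‖ₑ ≤ ∫⁻ w in ball c R, ‖g w‖ₑ := by
  set F : ℂ → ℝ≥0∞ := (ball c R).indicator fun w => ‖g w‖ₑ with hF
  have hcont : ContinuousOn (fun w => ‖g w‖ₑ) (ball c R) := hg.continuousOn.enorm
  have hFm : Measurable F := by
    refine measurable_of_restrict_of_restrict_compl (s := ball c R)
      isOpen_ball.measurableSet ?_ ?_
    · have : (ball c R).domRestrict F = (ball c R).domRestrict fun w => ‖g w‖ₑ := by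
        ext x
        simp [hF]
      rw [this]
      exact hcont.domRestrict.measurable
    · have : (ball c R)ᶜ.domRestrict F = fun _ => 0 := by
        ext x
        simp [hF, Set.indicator_of_notMem x.2]
      rw [this]
      exact measurable_const
  have h1 : ∫⁻ w in ball c R, ‖g w‖ₑ = ∫⁻ w, F (c + w) := by
    rw [lintegral_add_left_eq_self F c, hF, lintegral_indicator isOpen_ball.measurableSet]
  rw [h1, ← Complex.lintegral_comp_polarCoord_symm]
  have hm2 : Measurable fun p : ℝ × ℝ =>
      ENNReal.ofReal p.1 • F (c + Complex.polarCoord.symm p) := by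
    have : Measurable fun p : ℝ × ℝ => c + Complex.polarCoord.symm p := by
      simp only [Complex.polarCoord_symm_apply]
      fun_prop
    exact (by fun_prop : Measurable fun p : ℝ × ℝ => ENNReal.ofReal p.1).mul (hFm.comp this)
  have htar : polarCoord.target = Set.Ioi (0 : ℝ) ×ˢ Set.Ioo (-π) π := rfl
  rw [htar, Measure.volume_eq_prod, ← Measure.prod_restrict, lintegral_prod _ hm2.aemeasurable]
  have hint : ∫⁻ ρ in Set.Ioo (0 : ℝ) R, ENNReal.ofReal (2 * π * ρ) =
      ENNReal.ofReal (π * R ^ 2) := by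
    rw [← ofReal_integral_eq_lintegral_ofReal]
    · congr 1
      rw [← integral_Ioc_eq_integral_Ioo, ← intervalIntegral.integral_of_le hR.le,
        intervalIntegral.integral_const_mul, integral_id]
      ring
    · exact ((continuous_const.mul continuous_id).integrableOn_Icc (a := 0) (b := R)).mono_set
        Set.Ioo_subset_Icc_self
    · refine (ae_restrict_iff' measurableSet_Ioo).2 (ae_of_all _ fun ρ hρ => ?_)
      have := hρ.1
      positivity
  calc ENNReal.ofReal (π * R ^ 2) * ‖g c‖ₑ
      = ∫⁻ ρ in Set.Ioo (0 : ℝ) R, ENNReal.ofReal (2 * π * ρ) * ‖g c‖ₑ := by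
        rw [lintegral_mul_const _ (by fun_prop), hint]
    _ ≤ ∫⁻ ρ in Set.Ioo (0 : ℝ) R, ∫⁻ θ in Set.Ioo (-π) π,
          ENNReal.ofReal ρ • F (c + Complex.polarCoord.symm (ρ, θ)) := by
        refine setLIntegral_mono' measurableSet_Ioo fun ρ hρ => ?_
        have hin : ∀ θ : ℝ, F (c + Complex.polarCoord.symm (ρ, θ)) = ‖g (circleMap c ρ θ)‖ₑ := by
          intro θ
          have he : c + Complex.polarCoord.symm (ρ, θ) = circleMap c ρ θ := by
            simp [circleMap, Complex.exp_mul_I]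
          rw [he, hF]
          refine Set.indicator_of_mem ?_ _
          rw [mem_ball, dist_eq_norm]
          simpa [circleMap, abs_of_pos hρ.1] using hρ.2
        simp_rw [hin, smul_eq_mul]
        rw [lintegral_const_mul' _ _ ENNReal.ofReal_ne_top, mul_comm (2 * π) ρ,
          ENNReal.ofReal_mul hρ.1.le, mul_assoc]
        gcongr
        exact Bergman.circle_bound hg hρ.1 hρ.2
    _ ≤ _ := lintegral_mono_set Set.Ioo_subset_Ioi_self

/-- Point evaluations are bounded on square integrable holomorphic functions. -/
theorem Bergman.eval_bound {Ω : Set ℂ} {g : ℂ → ℂ} {c : ℂ} {R : ℝ} (hR : 0 < R)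
    (hΩ : ball c R ⊆ Ω) (hg : DifferentiableOn ℂ g Ω) :
    ‖g c‖ₑ ≤ (ENNReal.ofReal (π * R ^ 2))⁻¹ * (ENNReal.ofReal (π * R ^ 2)) ^ (1 / 2 : ℝ) *
      eLpNorm g 2 (volume.restrict Ω) := by
  have hb := Bergman.ball_bound hR (hg.mono hΩ)
  have hpos : 0 < π * R ^ 2 := by positivity
  have hm : AEStronglyMeasurable g (volume.restrict (ball c R)) :=
    (hg.mono hΩ).continuousOn.aestronglyMeasurable isOpen_ball.measurableSet
  have h2 := eLpNorm_le_eLpNorm_mul_rpow_measure_univ (p := 1) (q := 2) (by norm_num) hm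
  rw [eLpNorm_one_eq_lintegral_enorm] at h2
  have hvol : volume.restrict (ball c R) Set.univ = ENNReal.ofReal (π * R ^ 2) := by
    rw [Measure.restrict_apply_univ, Complex.volume_ball, mul_comm π,
      ENNReal.ofReal_mul (by positivity), ENNReal.ofReal_pow hR.le]
    congr 1
    rw [← NNReal.coe_real_pi, ENNReal.ofReal_coe_nnreal]
  rw [hvol] at h2
  have hexp : (1 / (1 : ℝ≥0∞).toReal - 1 / (2 : ℝ≥0∞).toReal) = (1 / 2 : ℝ) := by norm_num
  rw [hexp] at h2
  have h3 : eLpNorm g 2 (volume.restrict (ball c R)) ≤ eLpNorm g 2 (volume.restrict Ω) :=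
    eLpNorm_mono_measure _ (Measure.restrict_mono hΩ le_rfl)
  have h4 : ENNReal.ofReal (π * R ^ 2) * ‖g c‖ₑ ≤
      (ENNReal.ofReal (π * R ^ 2)) ^ (1 / 2 : ℝ) * eLpNorm g 2 (volume.restrict Ω) := by
    refine hb.trans (h2.trans ?_)
    rw [mul_comm]
    gcongr
  rw [mul_assoc, ← ENNReal.div_eq_inv_mul,
    ENNReal.le_div_iff_mul_le (Or.inl (by simpa using hpos)) (Or.inl ENNReal.ofReal_ne_top),
    mul_comm]
  exact h4

/-- The Bergman space `L² ∩ 𝒪(Ω)` of square integrable holomorphic functions on an open set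
`Ω ⊆ ℂ`: the classes in `L²(Ω)` (Lebesgue measure) that have a holomorphic representative. -/
noncomputable def bergmanSpace (Ω : TopologicalSpace.Opens ℂ) :
    Submodule ℂ (Lp ℂ 2 (volume.restrict (Ω : Set ℂ))) where
  carrier := {f | ∃ g : ℂ → ℂ, DifferentiableOn ℂ g Ω ∧
    f =ᵐ[volume.restrict (Ω : Set ℂ)] g}
  add_mem' := by
    rintro a b ⟨g, hg, hga⟩ ⟨h, hh, hhb⟩
    exact ⟨g + h, hg.add hh, (Lp.coeFn_add a b).trans (hga.add hhb)⟩
  zero_mem' := ⟨0, differentiableOn_const 0, Lp.coeFn_zero _ _ _⟩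
  smul_mem' := by
    rintro c a ⟨g, hg, hga⟩
    exact ⟨c • g, hg.const_smul c, (Lp.coeFn_smul c a).trans (hga.const_smul c)⟩

/-- The value at `z` of an element of the Bergman space, through its holomorphic representative
(which is unique on `Ω`; only points `z ∈ Ω` are meaningful). -/
noncomputable def bergmanEval {Ω : TopologicalSpace.Opens ℂ} (f : bergmanSpace Ω) (z : ℂ) : ℂ :=
  Classical.choose f.2 z

theorem bergmanSpace_isClosed (Ω : TopologicalSpace.Opens ℂ) :
    IsClosed (bergmanSpace Ω : Set (Lp ℂ 2 (volume.restrict (Ω : Set ℂ)))) := by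
  refine isClosed_of_closure_subset fun u hu => ?_
  obtain ⟨x, hx, hxu⟩ := mem_closure_iff_seq_limit.1 hu
  choose g hgd hgx using hx
  have hnorm : ∀ n m, eLpNorm (g n - g m) 2 (volume.restrict (Ω : Set ℂ)) = ‖x n - x m‖ₑ := by
    intro n m
    rw [Lp.enorm_def]
    refine eLpNorm_congr_ae ?_
    exact (((Lp.coeFn_sub (x n) (x m)).trans ((hgx n).sub (hgx m)))).symm
  have hcau : CauchySeq x := hxu.cauchySeq
  have hloc : ∀ z ∈ Ω, ∃ R > 0, ball z R ⊆ Ω ∧ UniformCauchySeqOn g atTop (ball z R) := by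
    intro z hz
    obtain ⟨R, hR, hRΩ⟩ := Metric.isOpen_iff.1 Ω.isOpen z hz
    have hR2 : 0 < R / 2 := by positivity
    refine ⟨R / 2, hR2, (ball_subset_ball (by linarith)).trans hRΩ, ?_⟩
    set A : ℝ≥0∞ := (ENNReal.ofReal (π * (R / 2) ^ 2))⁻¹ *
      (ENNReal.ofReal (π * (R / 2) ^ 2)) ^ (1 / 2 : ℝ) with hA
    have hpos : 0 < π * (R / 2) ^ 2 := by positivity
    have hAtop : A ≠ ∞ := by
      refine ENNReal.mul_ne_top (ENNReal.inv_ne_top.2 ?_)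
        (ENNReal.rpow_ne_top_of_nonneg (by norm_num) ENNReal.ofReal_ne_top)
      simpa using hpos
    have hbd : ∀ n m, ∀ w ∈ ball z (R / 2), ‖g n w - g m w‖ ≤ A.toReal * ‖x n - x m‖ := by
      intro n m w hw
      have hsub : ball w (R / 2) ⊆ (Ω : Set ℂ) := by
        refine (ball_subset_ball' ?_).trans hRΩ
        rw [mem_ball] at hw
        linarith
      have := Bergman.eval_bound hR2 hsub ((hgd n).sub (hgd m))
      rw [hnorm n m] at this
      have h2 := ENNReal.toReal_mono (ENNReal.mul_ne_top hAtop enorm_ne_top) this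
      rw [ENNReal.toReal_mul, toReal_enorm, toReal_enorm] at h2
      exact h2
    rw [Metric.uniformCauchySeqOn_iff]
    intro ε hε
    obtain ⟨N, hN⟩ := Metric.cauchySeq_iff.1 hcau (ε / (A.toReal + 1)) (by positivity)
    refine ⟨N, fun m hm n hn w hw => ?_⟩
    have h1 := hN m hm n hn
    rw [dist_eq_norm] at h1 ⊢
    refine (hbd m n w hw).trans_lt ?_
    rw [lt_div_iff₀ (by positivity)] at h1
    nlinarith [norm_nonneg (x m - x n), ENNReal.toReal_nonneg (a := A)]
  have hlim : ∀ z ∈ Ω, ∃ y, Tendsto (fun n => g n z) atTop (𝓝 y) := by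
    intro z hz
    obtain ⟨R, hR, -, hc⟩ := hloc z hz
    exact cauchySeq_tendsto_of_complete (hc.cauchySeq (mem_ball_self hR))
  choose! h hh using hlim
  have hd : DifferentiableOn ℂ h Ω := by
    refine TendstoLocallyUniformlyOn.differentiableOn (F := g) (φ := atTop) ?_
      (Eventually.of_forall hgd) Ω.isOpen
    rw [Metric.tendstoLocallyUniformlyOn_iff]
    intro ε hε z hz
    obtain ⟨R, hR, hRΩ, hc⟩ := hloc z hz
    refine ⟨ball z R, mem_nhdsWithin_of_mem_nhds (ball_mem_nhds z hR), ?_⟩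
    exact Metric.tendstoUniformlyOn_iff.1
      (hc.tendstoUniformlyOn_of_tendsto fun w hw => hh w (hRΩ hw)) ε hε
  refine ⟨h, hd, ?_⟩
  obtain ⟨ns, hns, hae⟩ := (tendstoInMeasure_of_tendsto_Lp hxu).exists_seq_tendsto_ae
  have hall := ae_all_iff.2 hgx
  have hmem : ∀ᵐ w ∂(volume.restrict (Ω : Set ℂ)), w ∈ Ω :=
    ae_restrict_mem Ω.isOpen.measurableSet
  filter_upwards [hae, hall, hmem] with w hw hw2 hw3
  refine tendsto_nhds_unique hw ?_
  simp only [hw2]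
  exact (hh w hw3).comp hns.tendsto_atTop

instance bergmanSpace_completeSpace (Ω : TopologicalSpace.Opens ℂ) :
    CompleteSpace (bergmanSpace Ω) :=
  (bergmanSpace_isClosed Ω).completeSpace_coe

/-! ### The Bergman kernel -/

/-- The index set of an orthonormal (Hilbert) basis of the Bergman space. -/
noncomputable def bergmanBasisSet (Ω : TopologicalSpace.Opens ℂ) : Set (bergmanSpace Ω) :=
  Classical.choose (exists_hilbertBasis ℂ (bergmanSpace Ω))

/-- An orthonormal (Hilbert) basis of the Bergman space. -/
noncomputable def bergmanBasis (Ω : TopologicalSpace.Opens ℂ) :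
    HilbertBasis (bergmanBasisSet Ω) ℂ (bergmanSpace Ω) :=
  Classical.choose (Classical.choose_spec (exists_hilbertBasis ℂ (bergmanSpace Ω)))

/-- The Bergman kernel `K(z, w) = ∑ᵢ φᵢ(z) * conj φᵢ(w)` of `Ω`, where `φ` is an orthonormal basis
of the Bergman space (on `Ω × Ω` the series converges absolutely and its sum does not depend on
the basis). -/
noncomputable def bergmanKernel (Ω : TopologicalSpace.Opens ℂ) (z w : ℂ) : ℂ :=
  ∑' i, bergmanEval (bergmanBasis Ω i) z * (starRingEnd ℂ) (bergmanEval (bergmanBasis Ω i) w)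

/-! ### The Bergman metric and distance -/

/-- The Wirtinger derivative `∂u/∂z = (1/2) (∂u/∂x - i ∂u/∂y)`. -/
noncomputable def wirtingerDz (u : ℂ → ℂ) (z : ℂ) : ℂ :=
  (1 / 2 : ℂ) * (fderiv ℝ u z 1 - Complex.I * fderiv ℝ u z Complex.I)

/-- The Wirtinger derivative `∂u/∂z̄ = (1/2) (∂u/∂x + i ∂u/∂y)`. -/
noncomputable def wirtingerDzBar (u : ℂ → ℂ) (z : ℂ) : ℂ :=
  (1 / 2 : ℂ) * (fderiv ℝ u z 1 + Complex.I * fderiv ℝ u z Complex.I)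

/-- The coefficient `T(z) = ∂²/∂z∂z̄ log K(z, z)` of the Bergman metric `T dz dz̄`
(on the diagonal `K` is real and nonnegative, and `T` is real). -/
noncomputable def bergmanMetricCoeff (Ω : TopologicalSpace.Opens ℂ) (z : ℂ) : ℝ :=
  (wirtingerDz (wirtingerDzBar fun ζ => (Real.log (bergmanKernel Ω ζ ζ).re : ℂ)) z).re

/-- The length `β(z, X) = √(T(z) |X|²)` of the vector `X` at `z` in the Bergman metric. -/
noncomputable def bergmanNorm (Ω : TopologicalSpace.Opens ℂ) (z X : ℂ) : ℝ :=
  √(bergmanMetricCoeff Ω z * ‖X‖ ^ 2)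

/-- `γ` restricted to `[0, 1]` is a piecewise `C¹` curve: there is a subdivision
`0 = t₀ < t₁ < ⋯ < tₙ = 1` such that `γ` is `C¹` on every `[tᵢ, tᵢ₊₁]`. -/
def IsPiecewiseC1 (γ : ℝ → ℂ) : Prop :=
  ∃ (n : ℕ) (t : Fin (n + 1) → ℝ), StrictMono t ∧ t 0 = 0 ∧ t (Fin.last n) = 1 ∧
    ∀ i : Fin n, ContDiffOn ℝ 1 γ (Set.Icc (t i.castSucc) (t i.succ))

/-- The length `∫₀¹ β(γ(t), γ'(t)) dt` of a curve in the Bergman metric, in `[0, ∞]`. -/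
noncomputable def bergmanLength (Ω : TopologicalSpace.Opens ℂ) (γ : ℝ → ℂ) : ℝ≥0∞ :=
  ∫⁻ t in Set.Icc (0 : ℝ) 1, ENNReal.ofReal (bergmanNorm Ω (γ t) (deriv γ t))

/-- The Bergman distance: the infimum of the lengths of the piecewise `C¹` curves in `Ω` from `z`
to `w` (it is `∞` if there is no such curve, which cannot happen in a domain). -/
noncomputable def bergmanDist (Ω : TopologicalSpace.Opens ℂ) (z w : ℂ) : ℝ≥0∞ :=
  ⨅ (γ : ℝ → ℂ) (_ : IsPiecewiseC1 γ ∧ (∀ t ∈ Set.Icc (0 : ℝ) 1, γ t ∈ Ω) ∧ γ 0 = z ∧ γ 1 = w),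
    bergmanLength Ω γ

/-- The open geodesic ball `{z ∈ Ω : dist_Ω(z, z₀) < R}` of the Bergman metric. -/
def bergmanBall (Ω : TopologicalSpace.Opens ℂ) (z₀ : ℂ) (R : ℝ) : Set ℂ :=
  {z | z ∈ Ω ∧ bergmanDist Ω z z₀ < ENNReal.ofReal R}

/-- The annulus `{z : r < |z| < 1}`. -/
def annulus (r : ℝ) : TopologicalSpace.Opens ℂ :=
  ⟨{z | r < ‖z‖ ∧ ‖z‖ < 1},
    (isOpen_lt continuous_const continuous_norm).inter (isOpen_lt continuous_norm continuous_const)⟩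

/-!
The Bergman kernel of `P_r = {r < |z| < 1}` is `K(z, w) = θ(z w̄) / (π z w̄)`, where, with `q = r²` and
`c = 1 / (2 log (1 / r))`,
`θ(l) = c + ∑_{k ≥ 1} k (lᵏ + (q / l)ᵏ) / (1 - qᵏ)`.
This is the Laurent series of the kernel (`bergmanKernel_annulus`): the monomials `zⁿ` are orthogonal
by Cauchy's theorem in polar coordinates, and complete since a function orthogonal to all of them has
vanishing Laurent coefficients.

Put `L = log (1 / r)`, which is large. For `|l|` between about `1 / L²` and `1 / L` the function `θ` is
relatively close to `c + l` (`norm_annulusTheta_sub_le`). Two things follow. First, `θ` has a zero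
`l = -s` with `s` close to `c`, so the kernel vanishes at the pair `(-a, a)` with `a = √s`. Secondly,
the Bergman metric, whose coefficient is the complex Laplacian of `log θ(|z|²)`, is at most about
`c / (c + |z|²)²` for `1 / L ≤ |z| ≤ a` (`log_laplacian_le`): this is the Fubini-Study metric of
`z / √c`, for which `±√c` are antipodal points at distance `2 arctan 1 = π / 2`. The geodesic through
the origin is not available, but the half ellipse with semi-axes `a` and `1 / L` is, and since
`1 / L` is small compared with `√c` its length tends to `π / 2` (`bergmanDist_le_of_metric_le`).
-/

/-! ### The Bergman kernel in an arbitrary Hilbert basis -/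

theorem bergmanEval_differentiableOn {Ω : TopologicalSpace.Opens ℂ} (f : bergmanSpace Ω) :
    DifferentiableOn ℂ (bergmanEval f) Ω :=
  (Classical.choose_spec f.2).1

theorem bergmanEval_ae_eq {Ω : TopologicalSpace.Opens ℂ} (f : bergmanSpace Ω) :
    (f : Lp ℂ 2 (volume.restrict (Ω : Set ℂ))) =ᵐ[volume.restrict (Ω : Set ℂ)] bergmanEval f :=
  (Classical.choose_spec f.2).2

/-- The holomorphic representative of a class in the Bergman space is unique on `Ω`. -/
theorem bergmanEval_eqOn {Ω : TopologicalSpace.Opens ℂ} (f : bergmanSpace Ω) {g : ℂ → ℂ}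
    (hg : DifferentiableOn ℂ g Ω)
    (hfg : (f : Lp ℂ 2 (volume.restrict (Ω : Set ℂ))) =ᵐ[volume.restrict (Ω : Set ℂ)] g) :
    Set.EqOn (bergmanEval f) g Ω :=
  Measure.eqOn_open_of_ae_eq ((bergmanEval_ae_eq f).symm.trans hfg) Ω.isOpen
    (bergmanEval_differentiableOn f).continuousOn hg.continuousOn

/-- Evaluation at a point of `Ω`, as a continuous linear functional on the Bergman space. -/
theorem exists_bergmanEvalCLM {Ω : TopologicalSpace.Opens ℂ} {z : ℂ} (hz : z ∈ Ω) :
    ∃ e : bergmanSpace Ω →L[ℂ] ℂ, ∀ f, e f = bergmanEval f z := by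
  obtain ⟨R, hR, hRΩ⟩ := Metric.isOpen_iff.1 Ω.isOpen z hz
  set A : ℝ≥0∞ := (ENNReal.ofReal (π * R ^ 2))⁻¹ *
      (ENNReal.ofReal (π * R ^ 2)) ^ (1 / 2 : ℝ) with hA
  have hpos : 0 < π * R ^ 2 := by positivity
  have hAtop : A ≠ ∞ := by
    refine ENNReal.mul_ne_top (ENNReal.inv_ne_top.2 ?_)
      (ENNReal.rpow_ne_top_of_nonneg (by norm_num) ENNReal.ofReal_ne_top)
    simpa using hpos
  let l : bergmanSpace Ω →ₗ[ℂ] ℂ :=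
    { toFun := fun f => bergmanEval f z
      map_add' := fun f g => bergmanEval_eqOn (f + g)
        ((bergmanEval_differentiableOn f).add (bergmanEval_differentiableOn g))
        ((Lp.coeFn_add _ _).trans ((bergmanEval_ae_eq f).add (bergmanEval_ae_eq g))) hz
      map_smul' := fun c f => bergmanEval_eqOn (c • f)
        ((bergmanEval_differentiableOn f).const_smul c)
        ((Lp.coeFn_smul _ _).trans ((bergmanEval_ae_eq f).const_smul c)) hz }
  refine ⟨l.mkContinuous A.toReal fun f => ?_, fun f => rfl⟩
  have h1 := Bergman.eval_bound hR hRΩ (bergmanEval_differentiableOn f)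
  rw [← eLpNorm_congr_ae (bergmanEval_ae_eq f), ← Lp.enorm_def] at h1
  have h2 := ENNReal.toReal_mono (ENNReal.mul_ne_top hAtop enorm_ne_top) h1
  rw [ENNReal.toReal_mul, toReal_enorm, toReal_enorm] at h2
  exact h2

/-- For any Hilbert basis, the series that defines the kernel sums to the inner product of the Riesz
representatives of the evaluations at `z` and `w`. -/
theorem hasSum_bergmanEval_mul_conj {Ω : TopologicalSpace.Opens ℂ} {ι : Type*}
    (b : HilbertBasis ι ℂ (bergmanSpace Ω)) {z w : ℂ} {e e' : bergmanSpace Ω →L[ℂ] ℂ}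
    (he : ∀ f, e f = bergmanEval f z) (he' : ∀ f, e' f = bergmanEval f w) :
    HasSum (fun i => bergmanEval (b i) z * (starRingEnd ℂ) (bergmanEval (b i) w))
      (inner ℂ ((InnerProductSpace.toDual ℂ (bergmanSpace Ω)).symm e)
        ((InnerProductSpace.toDual ℂ (bergmanSpace Ω)).symm e')) := by
  refine (b.hasSum_inner_mul_inner _ _).congr_fun fun i => ?_
  rw [← inner_conj_symm (b i), InnerProductSpace.toDual_symm_apply,
    InnerProductSpace.toDual_symm_apply, he, he']

/-- The Bergman kernel can be computed with any Hilbert basis. -/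
theorem hasSum_bergmanKernel {Ω : TopologicalSpace.Opens ℂ} {ι : Type*}
    (b : HilbertBasis ι ℂ (bergmanSpace Ω)) {z w : ℂ} (hz : z ∈ Ω) (hw : w ∈ Ω) :
    HasSum (fun i => bergmanEval (b i) z * (starRingEnd ℂ) (bergmanEval (b i) w))
      (bergmanKernel Ω z w) := by
  obtain ⟨e, he⟩ := exists_bergmanEvalCLM hz
  obtain ⟨e', he'⟩ := exists_bergmanEvalCLM hw
  rw [bergmanKernel, (hasSum_bergmanEval_mul_conj (bergmanBasis Ω) he he').tsum_eq]
  exact hasSum_bergmanEval_mul_conj b he he'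

/-! ### The monomials in the Bergman space of the annulus -/

/-- The Laurent coefficient of index `n` of `g`, times `2π`, computed on the circle of radius `ρ`. -/
noncomputable def circleCoeff (g : ℂ → ℂ) (n : ℤ) (ρ : ℝ) : ℂ :=
  ∫ θ in (0 : ℝ)..2 * π, circleMap 0 ρ θ ^ (-n) * g (circleMap 0 ρ θ)

theorem circleIntegral_inv_mul {f : ℂ → ℂ} {ρ : ℝ} (hρ : 0 < ρ) :
    (∮ z in C(0, ρ), (z - 0)⁻¹ • f z) =
      Complex.I * ∫ θ in (0 : ℝ)..2 * π, f (circleMap 0 ρ θ) := by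
  rw [circleIntegral, ← intervalIntegral.integral_const_mul]
  refine intervalIntegral.integral_congr fun θ _ => ?_
  have h := circleMap_ne_center (c := 0) (θ := θ) hρ.ne'
  simp only [deriv_circleMap, smul_eq_mul, sub_zero]
  field_simp

theorem mem_annulus {r : ℝ} {z : ℂ} : z ∈ annulus r ↔ r < ‖z‖ ∧ ‖z‖ < 1 := Iff.rfl

theorem circleMap_mem_annulus {r ρ : ℝ} (hr : 0 < r) (hρ : ρ ∈ Set.Ioo r 1) (θ : ℝ) :
    circleMap 0 ρ θ ∈ annulus r := by
  rw [mem_annulus, norm_circleMap_zero, abs_of_pos (hr.trans hρ.1)]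
  exact hρ

theorem ne_zero_of_mem_annulus {r : ℝ} (hr : 0 < r) {z : ℂ} (hz : z ∈ annulus r) : z ≠ 0 :=
  norm_pos_iff.1 (hr.trans hz.1)

theorem zpow_differentiableOn_annulus {r : ℝ} (hr : 0 < r) (n : ℤ) :
    DifferentiableOn ℂ (fun z : ℂ => z ^ n) (annulus r) := fun _ hz =>
  (differentiableAt_zpow.2 (Or.inl (ne_zero_of_mem_annulus hr hz))).differentiableWithinAt

/-- Cauchy's theorem: the Laurent coefficients do not depend on the radius. -/
theorem circleCoeff_eq {r : ℝ} (hr : 0 < r) {g : ℂ → ℂ} (hg : DifferentiableOn ℂ g (annulus r))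
    (n : ℤ) {ρ ρ' : ℝ} (hρ : ρ ∈ Set.Ioo r 1) (hρ' : ρ' ∈ Set.Ioo r 1) :
    circleCoeff g n ρ = circleCoeff g n ρ' := by
  wlog h : ρ' ≤ ρ generalizing ρ ρ'
  · exact (this hρ' hρ (le_of_not_ge h)).symm
  have hd : DifferentiableOn ℂ (fun z => z ^ (-n) * g z) (annulus r) :=
    (zpow_differentiableOn_annulus hr (-n)).mul hg
  have hsub : closedBall (0 : ℂ) ρ \ ball 0 ρ' ⊆ annulus r := by
    rintro z ⟨h1, h2⟩
    rw [mem_closedBall_zero_iff] at h1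
    rw [mem_ball_zero_iff, not_lt] at h2
    exact ⟨hρ'.1.trans_le h2, h1.trans_lt hρ.2⟩
  have key := Complex.circleIntegral_sub_center_inv_smul_eq_of_differentiable_on_annulus_off_countable
    (c := 0) (f := fun z => z ^ (-n) * g z) (hr.trans hρ'.1) h Set.countable_empty (hd.continuousOn.mono hsub) (fun z hz => by
      refine hd.differentiableAt ((annulus r).isOpen.mem_nhds (hsub ?_))
      exact ⟨ball_subset_closedBall hz.1.1, fun hb => hz.1.2 (ball_subset_closedBall hb)⟩)
  rw [circleIntegral_inv_mul (hr.trans hρ.1), circleIntegral_inv_mul (hr.trans hρ'.1)] at key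
  exact mul_left_cancel₀ Complex.I_ne_zero key

theorem circleCoeff_zpow {ρ : ℝ} (hρ : 0 < ρ) (n m : ℤ) :
    circleCoeff (fun z => z ^ n) m ρ = if m = n then 2 * (π : ℂ) else 0 := by
  have h0 : ∀ θ, circleMap 0 ρ θ ≠ 0 := fun θ => circleMap_ne_center hρ.ne'
  have h1 : circleCoeff (fun z => z ^ n) m ρ =
      ∫ θ in (0 : ℝ)..2 * π, circleMap 0 ρ θ ^ (n - m) := by
    refine intervalIntegral.integral_congr fun θ _ => ?_
    simp only
    rw [← zpow_add₀ (h0 θ)]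
    ring_nf
  rw [h1]
  split_ifs with h
  · simp [h]
  · refine mul_left_cancel₀ Complex.I_ne_zero ?_
    rw [← circleIntegral_inv_mul (f := fun z => z ^ (n - m)) hρ, mul_zero]
    refine Eq.trans ?_ (circleIntegral.integral_sub_zpow_of_ne (n := n - m - 1) (by omega) 0 0 ρ)
    refine circleIntegral.integral_congr (E := ℂ) hρ.le fun z hz => ?_
    have hz0 : z ≠ 0 := norm_pos_iff.1 (by rw [mem_sphere_zero_iff_norm.1 hz]; exact hρ)
    simp only [sub_zero, smul_eq_mul]
    rw [zpow_sub_one₀ hz0, mul_comm]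

/-- Integration in polar coordinates on the annulus. -/
theorem setIntegral_annulus {r : ℝ} (hr : 0 < r) {f : ℂ → ℂ}
    (hc : ContinuousOn f (annulus r)) (hi : IntegrableOn f (annulus r)) :
    ∫ z in (annulus r : Set ℂ), f z =
      ∫ ρ in Set.Ioo r 1, (ρ : ℂ) * ∫ θ in (0 : ℝ)..2 * π, f (circleMap 0 ρ θ) := by
  classical
  have hms : MeasurableSet (annulus r : Set ℂ) := (annulus r).isOpen.measurableSet
  set F : ℂ → ℂ := (annulus r : Set ℂ).indicator f with hF
  have hFm : Measurable F := by
    rw [hF, ← Set.piecewise_eq_indicator]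
    exact hc.measurable_piecewise continuousOn_const hms
  have hFi : Integrable F := (integrable_indicator_iff hms).2 hi
  have hpm : Measurable fun p : ℝ × ℝ => Complex.polarCoord.symm p := by
    simp only [Complex.polarCoord_symm_apply]
    fun_prop
  have hint : IntegrableOn (fun p : ℝ × ℝ => p.1 • F (Complex.polarCoord.symm p))
      polarCoord.target := by
    refine ⟨(measurable_fst.smul (hFm.comp hpm)).aestronglyMeasurable, ?_⟩
    have h1 := Complex.lintegral_comp_polarCoord_symm fun z => ‖F z‖ₑ
    rw [HasFiniteIntegral]
    refine lt_of_eq_of_lt ?_ (h1.trans_lt hFi.2)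
    refine setLIntegral_congr_fun polarCoord.open_target.measurableSet fun p hp => ?_
    simp only [enorm_smul, smul_eq_mul]
    rw [Real.enorm_eq_ofReal hp.1.le]
  have htar : polarCoord.target = Set.Ioi (0 : ℝ) ×ˢ Set.Ioo (-π) π := rfl
  rw [← integral_indicator hms, ← hF, ← Complex.integral_comp_polarCoord_symm, htar]
  rw [htar] at hint
  rw [Measure.volume_eq_prod] at hint ⊢
  have hpol : ∀ ρ θ : ℝ, Complex.polarCoord.symm (ρ, θ) = circleMap 0 ρ θ := fun ρ θ => by
    simp [circleMap, Complex.exp_mul_I]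
  rw [setIntegral_prod _ hint]
  simp only [hpol]
  rw [setIntegral_eq_of_subset_of_forall_sdiff_eq_zero measurableSet_Ioi
    (s := Set.Ioo r 1) (fun ρ hρ => hr.trans hρ.1)]
  · refine setIntegral_congr_fun measurableSet_Ioo fun ρ hρ => ?_
    have hper : Function.Periodic (fun θ => f (circleMap 0 ρ θ)) (2 * π) := fun θ => by
      simp only [periodic_circleMap 0 ρ θ]
    have h2 := hper.intervalIntegral_add_eq 0 (-π)
    rw [zero_add, show -π + 2 * π = π by ring, intervalIntegral.integral_of_le (a := -π)
      (by linarith [Real.pi_pos]), integral_Ioc_eq_integral_Ioo] at h2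
    rw [h2, integral_smul, Complex.real_smul]
    congr 1
    refine setIntegral_congr_fun measurableSet_Ioo fun θ _ => ?_
    exact Set.indicator_of_mem (circleMap_mem_annulus hr hρ θ) f
  · rintro ρ ⟨h0, h1⟩
    have h2 : ∀ θ, F (circleMap 0 ρ θ) = 0 := fun θ => by
      refine Set.indicator_of_notMem (fun hmem => h1 ?_) f
      have := mem_annulus.1 hmem
      rwa [norm_circleMap_zero, abs_of_pos h0] at this
    simp [h2]

/-- On the circle of radius `ρ` one has `conj z = ρ² / z`. -/
theorem star_circleMap_zpow {ρ : ℝ} (hρ : 0 < ρ) (n : ℤ) (θ : ℝ) :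
    (starRingEnd ℂ) (circleMap 0 ρ θ ^ n) = (ρ : ℂ) ^ (2 * n) * circleMap 0 ρ θ ^ (-n) := by
  have h0 : circleMap 0 ρ θ ≠ 0 := circleMap_ne_center hρ.ne'
  have h1 : (starRingEnd ℂ) (circleMap 0 ρ θ) = (ρ : ℂ) ^ (2 : ℤ) * (circleMap 0 ρ θ)⁻¹ := by
    rw [eq_mul_inv_iff_mul_eq₀ h0, Complex.conj_mul', norm_circleMap_zero, abs_of_pos hρ]
    norm_cast
  rw [map_zpow₀, h1, mul_zpow, ← zpow_mul, inv_zpow, zpow_neg]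

/-- The radial integral `∫ ρ²ⁿ⁺¹ dρ` over `(r, 1)`; the squared norm of `zⁿ` is `2π` times it. -/
noncomputable def radialMoment (r : ℝ) (n : ℤ) : ℝ := ∫ ρ in r..1, ρ ^ (2 * n + 1)

theorem setIntegral_annulus_star_zpow_mul {r : ℝ} (hr : 0 < r) (hr1 : r < 1) {g : ℂ → ℂ}
    (hg : DifferentiableOn ℂ g (annulus r)) (n : ℤ)
    (hi : IntegrableOn (fun z => (starRingEnd ℂ) (z ^ n) * g z) (annulus r))
    {ρ : ℝ} (hρ : ρ ∈ Set.Ioo r 1) :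
    ∫ z in (annulus r : Set ℂ), (starRingEnd ℂ) (z ^ n) * g z =
      radialMoment r n * circleCoeff g n ρ := by
  have hc : ContinuousOn (fun z => (starRingEnd ℂ) (z ^ n) * g z) (annulus r) :=
    ((zpow_differentiableOn_annulus hr n).continuousOn.star).mul hg.continuousOn
  rw [setIntegral_annulus hr hc hi, radialMoment, intervalIntegral.integral_of_le hr1.le,
    integral_Ioc_eq_integral_Ioo, ← integral_complex_ofReal, ← integral_mul_const]
  refine setIntegral_congr_fun measurableSet_Ioo fun x hx => ?_
  have hx0 : 0 < x := hr.trans hx.1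
  simp only [star_circleMap_zpow hx0]
  rw [circleCoeff_eq hr hg n hρ hx, circleCoeff]
  simp_rw [mul_assoc]
  rw [intervalIntegral.integral_const_mul, ← mul_assoc]
  congr 1
  push_cast
  rw [zpow_add_one₀ (by exact_mod_cast hx0.ne'), mul_comm]

theorem radialMoment_pos {r : ℝ} (hr : 0 < r) (hr1 : r < 1) (n : ℤ) : 0 < radialMoment r n := by
  refine intervalIntegral.intervalIntegral_pos_of_pos_on ?_
    (fun x hx => zpow_pos (hr.trans hx.1) _) hr1
  refine ContinuousOn.intervalIntegrable fun x hx => ?_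
  rw [Set.uIcc_of_le hr1.le] at hx
  exact (continuousAt_zpow₀ x _ (Or.inl (hr.trans_le hx.1).ne')).continuousWithinAt

theorem radialMoment_neg_one {r : ℝ} (hr : 0 < r) : radialMoment r (-1) = -Real.log r := by
  have h : radialMoment r (-1) = ∫ ρ in r..1, ρ⁻¹ := by
    simp [radialMoment]
  rw [h, integral_inv_of_pos hr one_pos, one_div, Real.log_inv]

theorem radialMoment_sub_one {r : ℝ} (hr : 0 < r) (hr1 : r < 1) {k : ℤ} (hk : k ≠ 0) :
    radialMoment r (k - 1) = (1 - (r ^ 2) ^ k) / (2 * k) := by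
  rw [radialMoment, integral_zpow (Or.inr ⟨by omega, ?_⟩)]
  · rw [show 2 * (k - 1) + 1 + 1 = 2 * k by ring, one_zpow, zpow_mul]
    push_cast
    congr 1
    ring
  · rw [Set.uIcc_of_le hr1.le]
    exact fun h => hr.not_ge h.1

theorem zpow_memLp_annulus {r : ℝ} (hr : 0 < r) (n : ℤ) :
    MemLp (fun z : ℂ => z ^ n) 2 (volume.restrict (annulus r : Set ℂ)) := by
  have hms : MeasurableSet (annulus r : Set ℂ) := (annulus r).isOpen.measurableSet
  have hfin : IsFiniteMeasure (volume.restrict (annulus r : Set ℂ)) := by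
    refine ⟨?_⟩
    rw [Measure.restrict_apply_univ]
    refine lt_of_le_of_lt (measure_mono fun z hz => ?_) (measure_ball_lt_top (x := (0 : ℂ)) (r := 1))
    exact mem_ball_zero_iff.2 hz.2
  refine MemLp.of_bound ((zpow_differentiableOn_annulus hr n).continuousOn.aestronglyMeasurable hms)
    (max 1 (r ^ n)) ?_
  filter_upwards [ae_restrict_mem hms] with z hz
  rw [norm_zpow]
  rcases le_total 0 n with h | h
  · refine le_max_of_le_left ?_
    lift n to ℕ using h
    rw [zpow_natCast]
    exact pow_le_one₀ (norm_nonneg z) hz.2.le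
  · refine le_max_of_le_right ?_
    obtain ⟨m, rfl⟩ := Int.exists_eq_neg_ofNat h
    simp only [zpow_neg, zpow_natCast]
    have := hz.1.le
    gcongr

/-- The monomial `zⁿ`, as an element of the Bergman space of the annulus. -/
noncomputable def annulusMonomial {r : ℝ} (hr : 0 < r) (n : ℤ) : bergmanSpace (annulus r) :=
  ⟨(zpow_memLp_annulus hr n).toLp _, fun z => z ^ n, zpow_differentiableOn_annulus hr n,
    MemLp.coeFn_toLp _⟩

theorem bergmanEval_smul_annulusMonomial {r : ℝ} (hr : 0 < r) (n : ℤ) (a : ℂ) {z : ℂ}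
    (hz : z ∈ annulus r) :
    bergmanEval (a • annulusMonomial hr n) z = a * z ^ n :=
  bergmanEval_eqOn (a • annulusMonomial hr n)
    ((zpow_differentiableOn_annulus hr n).const_smul a)
    ((Lp.coeFn_smul _ _).trans ((MemLp.coeFn_toLp (zpow_memLp_annulus hr n)).const_smul a)) hz

/-- The inner product with `zⁿ` is a positive multiple of the `n`-th Laurent coefficient. -/
theorem inner_annulusMonomial {r : ℝ} (hr : 0 < r) (hr1 : r < 1) (n : ℤ)
    (f : bergmanSpace (annulus r)) {g : ℂ → ℂ} (hg : DifferentiableOn ℂ g (annulus r))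
    (hfg : (f : Lp ℂ 2 (volume.restrict (annulus r : Set ℂ))) =ᵐ[volume.restrict
      (annulus r : Set ℂ)] g) {ρ : ℝ} (hρ : ρ ∈ Set.Ioo r 1) :
    inner ℂ (annulusMonomial hr n) f = radialMoment r n * circleCoeff g n ρ := by
  have hae : (fun z => inner ℂ ((annulusMonomial hr n : Lp ℂ 2 (volume.restrict
      (annulus r : Set ℂ))) z) ((f : Lp ℂ 2 (volume.restrict (annulus r : Set ℂ))) z))
      =ᵐ[volume.restrict (annulus r : Set ℂ)] fun z => (starRingEnd ℂ) (z ^ n) * g z := by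
    have hm : (annulusMonomial hr n : Lp ℂ 2 (volume.restrict (annulus r : Set ℂ)))
      =ᵐ[volume.restrict (annulus r : Set ℂ)] fun z => z ^ n := MemLp.coeFn_toLp (zpow_memLp_annulus hr n)
    filter_upwards [hfg, hm] with z h1 h2
    rw [h1, h2, RCLike.inner_apply, mul_comm]
  rw [Submodule.coe_inner, L2.inner_def, integral_congr_ae hae]
  exact setIntegral_annulus_star_zpow_mul hr hr1 hg n ((L2.integrable_inner _ _).congr hae) hρ

theorem inner_annulusMonomial_annulusMonomial {r : ℝ} (hr : 0 < r) (hr1 : r < 1) (n m : ℤ) :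
    inner ℂ (annulusMonomial hr n) (annulusMonomial hr m) =
      if n = m then (2 * π * radialMoment r n : ℂ) else 0 := by
  have hρ : (r + 1) / 2 ∈ Set.Ioo r 1 := ⟨by linarith, by linarith⟩
  rw [inner_annulusMonomial hr hr1 n _ (zpow_differentiableOn_annulus hr m)
      (MemLp.coeFn_toLp (zpow_memLp_annulus hr m)) hρ,
    circleCoeff_zpow (hr.trans hρ.1)]
  split_ifs <;> ring

/-- A continuous function on a circle all of whose Fourier coefficients vanish is zero there. -/
theorem eq_zero_of_circleCoeff_eq_zero {r : ℝ} (hr : 0 < r) {g : ℂ → ℂ}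
    (hg : ContinuousOn g (annulus r)) {ρ : ℝ} (hρ : ρ ∈ Set.Ioo r 1)
    (h : ∀ n, circleCoeff g n ρ = 0) (θ : ℝ) : g (circleMap 0 ρ θ) = 0 := by
  have hρ0 : 0 < ρ := hr.trans hρ.1
  have : Fact (0 < 2 * π) := ⟨Real.two_pi_pos⟩
  have hto : ∀ x : ℝ, (ρ : ℂ) * (AddCircle.toCircle (x : AddCircle (2 * π)) : ℂ) =
      circleMap 0 ρ x := by
    intro x
    rw [AddCircle.toCircle_apply_mk, Circle.coe_exp, circleMap]
    have := Real.two_pi_pos.ne'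
    rw [div_self this, one_mul, zero_add]
  let F : C(AddCircle (2 * π), ℂ) := ⟨fun x => g (ρ * (AddCircle.toCircle x : ℂ)), by
    refine hg.comp_continuous
      (continuous_const.mul (continuous_subtype_val.comp AddCircle.continuous_toCircle))
      fun x => ?_
    rw [SetLike.mem_coe, mem_annulus, norm_mul, Circle.norm_coe, mul_one, Complex.norm_real,
      Real.norm_of_nonneg hρ0.le]
    exact hρ⟩
  have hF : ∀ x : ℝ, F (x : AddCircle (2 * π)) = g (circleMap 0 ρ x) := fun x => by
    rw [← hto x]; rfl
  have hcoeff : fourierCoeff F = fun _ => 0 := by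
    funext n
    rw [fourierCoeff_eq_intervalIntegral F n 0, zero_add]
    have h1 : (∫ x in (0 : ℝ)..2 * π, fourier (-n) (x : AddCircle (2 * π)) • F x) =
        (ρ : ℂ) ^ n * circleCoeff g n ρ := by
      rw [circleCoeff, ← intervalIntegral.integral_const_mul]
      refine intervalIntegral.integral_congr fun x _ => ?_
      simp only [hF, smul_eq_mul]
      rw [← mul_assoc]
      congr 1
      rw [← hto x, mul_zpow, ← mul_assoc, zpow_neg, mul_inv_cancel₀, one_mul, fourier_apply,
        AddCircle.toCircle_zsmul, Circle.coe_zpow]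
      exact zpow_ne_zero _ (by exact_mod_cast hρ0.ne')
    rw [h1, h n, mul_zero, smul_zero]
  have hsum := hasSum_fourier_series_of_summable (f := F) (by rw [hcoeff]; exact summable_zero)
  simp only [hcoeff, zero_smul] at hsum
  have hF0 : F = 0 := hsum.unique hasSum_zero
  rw [← hF θ, hF0, ContinuousMap.zero_apply]

/-- The monomials span a dense subspace: a function orthogonal to all of them has vanishing Laurent
coefficients, hence vanishes on every circle. -/
theorem eq_zero_of_inner_annulusMonomial {r : ℝ} (hr : 0 < r) (hr1 : r < 1)
    (f : bergmanSpace (annulus r)) (h : ∀ n, inner ℂ (annulusMonomial hr n) f = 0) : f = 0 := by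
  have hzero : ∀ z ∈ annulus r, bergmanEval f z = 0 := by
    intro z hz
    have hz' : circleMap 0 ‖z‖ (Complex.arg z) = z := by
      rw [circleMap, zero_add, Complex.norm_mul_exp_arg_mul_I]
    rw [← hz']
    refine eq_zero_of_circleCoeff_eq_zero hr (bergmanEval_differentiableOn f).continuousOn hz
      (fun n => ?_) _
    have h1 := h n
    rw [inner_annulusMonomial hr hr1 n f (bergmanEval_differentiableOn f) (bergmanEval_ae_eq f)
      hz] at h1
    exact (mul_eq_zero.1 h1).resolve_left (by exact_mod_cast (radialMoment_pos hr hr1 n).ne')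
  refine Subtype.ext (Lp.ext ?_)
  filter_upwards [bergmanEval_ae_eq f, ae_restrict_mem (annulus r).isOpen.measurableSet,
    Lp.coeFn_zero ℂ 2 (volume.restrict (annulus r : Set ℂ))] with z h1 h2 h3
  rw [h1, hzero z h2]
  exact h3.symm

/-- The Laurent series of the Bergman kernel of the annulus. -/
theorem hasSum_bergmanKernel_annulus {r : ℝ} (hr : 0 < r) (hr1 : r < 1) {z w : ℂ}
    (hz : z ∈ annulus r) (hw : w ∈ annulus r) :
    HasSum (fun n : ℤ => (z * (starRingEnd ℂ) w) ^ n / (2 * π * radialMoment r n))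
      (bergmanKernel (annulus r) z w) := by
  have hN : ∀ n, 0 < 2 * π * radialMoment r n := fun n =>
    mul_pos Real.two_pi_pos (radialMoment_pos hr hr1 n)
  set s : ℤ → ℝ := fun n => (√(2 * π * radialMoment r n))⁻¹
  have hs : ∀ n, (s n : ℂ) * s n = (2 * π * radialMoment r n : ℂ)⁻¹ := fun n => by
    rw [← Complex.ofReal_mul, ← mul_inv, Real.mul_self_sqrt (hN n).le]
    push_cast
    rfl
  set v : ℤ → bergmanSpace (annulus r) := fun n => (s n : ℂ) • annulusMonomial hr n with hv
  have hon : Orthonormal ℂ v := by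
    rw [orthonormal_iff_ite]
    intro n m
    rw [hv, inner_smul_left (𝕜 := ℂ) (E := bergmanSpace (annulus r)),
      inner_smul_right (𝕜 := ℂ) (E := bergmanSpace (annulus r)), inner_annulusMonomial_annulusMonomial hr hr1,
      Complex.conj_ofReal]
    split_ifs with h
    · subst h
      rw [← mul_assoc, hs, inv_mul_cancel₀]
      exact_mod_cast (hN n).ne'
    · simp
  have hbot : (Submodule.span ℂ (Set.range v))ᗮ = ⊥ := by
    rw [Submodule.eq_bot_iff]
    intro f hf
    refine eq_zero_of_inner_annulusMonomial hr hr1 f fun n => ?_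
    have h1 := (Submodule.mem_orthogonal _ f).1 hf (v n) (Submodule.subset_span ⟨n, rfl⟩)
    rw [hv, inner_smul_left (𝕜 := ℂ) (E := bergmanSpace (annulus r)), Complex.conj_ofReal] at h1
    refine (mul_eq_zero.1 h1).resolve_left ?_
    exact_mod_cast (inv_pos.2 (Real.sqrt_pos.2 (hN n))).ne'
  have key := hasSum_bergmanKernel (HilbertBasis.mkOfOrthogonalEqBot hon hbot) hz hw
  refine key.congr_fun fun n => ?_
  rw [HilbertBasis.coe_mkOfOrthogonalEqBot, bergmanEval_smul_annulusMonomial hr n _ hz,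
    bergmanEval_smul_annulusMonomial hr n _ hw, map_mul, Complex.conj_ofReal, map_zpow₀, mul_zpow,
    div_eq_mul_inv, ← hs]
  ring

/-! ### The Bergman kernel of the annulus as a Lambert series -/

/-- The coefficient of `lᵏ⁺¹` in `lambertSeries q l`. -/
noncomputable def lambertCoeff (q : ℝ) (k : ℕ) : ℝ := (k + 1) / (1 - q ^ (k + 1))

/-- The series `∑_{k ≥ 1} k lᵏ / (1 - qᵏ)`. -/
noncomputable def lambertSeries (q : ℝ) (l : ℂ) : ℂ := ∑' k : ℕ, (lambertCoeff q k : ℂ) * l ^ (k + 1)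

/-- The function `c + ∑_{k ≥ 1} k (lᵏ + (q / l)ᵏ) / (1 - qᵏ)`. For `q = r²` and
`c = 1 / (2 log (1 / r))` it is `π l` times the Bergman kernel of the annulus, `l` being `z * conj w`. -/
noncomputable def annulusTheta (q c : ℝ) (l : ℂ) : ℂ :=
  c + lambertSeries q l + lambertSeries q (q / l)

theorem lambertCoeff_nonneg {q : ℝ} (hq0 : 0 ≤ q) (hq : q ≤ 1 / 2) (k : ℕ) :
    0 ≤ lambertCoeff q k := by
  have : q ^ (k + 1) ≤ q := pow_le_of_le_one hq0 (by linarith) k.succ_ne_zero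
  exact div_nonneg (by positivity) (by linarith)

theorem lambertCoeff_le {q : ℝ} (hq0 : 0 ≤ q) (hq : q ≤ 1 / 2) (k : ℕ) :
    lambertCoeff q k ≤ 2 * (k + 1) := by
  have : q ^ (k + 1) ≤ q := pow_le_of_le_one hq0 (by linarith) k.succ_ne_zero
  rw [lambertCoeff, div_le_iff₀ (by linarith)]
  nlinarith [(Nat.cast_nonneg k : (0 : ℝ) ≤ k)]

theorem norm_lambertCoeff_mul_pow_le {q : ℝ} (hq0 : 0 ≤ q) (hq : q ≤ 1 / 2) (k : ℕ) {l : ℂ} {x : ℝ}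
    (hl : ‖l‖ ≤ x) (m : ℕ) :
    ‖(lambertCoeff q k : ℂ) * l ^ m‖ ≤ 2 * (k + 1) * x ^ m := by
  rw [norm_mul, norm_pow, Complex.norm_real, Real.norm_of_nonneg (lambertCoeff_nonneg hq0 hq k)]
  have := lambertCoeff_le hq0 hq k
  gcongr

theorem summable_two_mul_succ_mul_pow {x : ℝ} (hx0 : 0 ≤ x) (hx : x < 1) :
    Summable fun k : ℕ => 2 * ((k : ℝ) + 1) * x ^ (k + 1) := by
  have h1 := summable_pow_mul_geometric_of_norm_lt_one (R := ℝ) 1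
    (by rwa [Real.norm_of_nonneg hx0] : ‖x‖ < 1)
  have h2 := summable_geometric_of_lt_one hx0 hx
  refine ((h1.add h2).mul_left (2 * x)).congr fun k => ?_
  ring

theorem hasSum_lambertSeries {q : ℝ} (hq0 : 0 ≤ q) (hq : q ≤ 1 / 2) {l : ℂ} (hl : ‖l‖ < 1) :
    HasSum (fun k : ℕ => (lambertCoeff q k : ℂ) * l ^ (k + 1)) (lambertSeries q l) :=
  (Summable.of_norm_bounded (summable_two_mul_succ_mul_pow (norm_nonneg l) hl) fun k =>
    norm_lambertCoeff_mul_pow_le hq0 hq k le_rfl (k + 1)).hasSum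

theorem lambertSeries_differentiableOn {q : ℝ} (hq0 : 0 ≤ q) (hq : q ≤ 1 / 2) :
    DifferentiableOn ℂ (lambertSeries q) (ball 0 (1 / 2)) := by
  refine Complex.differentiableOn_tsum_of_summable_norm
    (summable_two_mul_succ_mul_pow (x := 1 / 2) (by norm_num) (by norm_num))
    (fun k => by fun_prop) isOpen_ball fun k l hl => ?_
  exact norm_lambertCoeff_mul_pow_le hq0 hq k (mem_ball_zero_iff.1 hl).le (k + 1)

theorem norm_lambertSeries_sub_le {q : ℝ} (hq0 : 0 ≤ q) (hq : q ≤ 1 / 2) {l : ℂ}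
    (hl : ‖l‖ ≤ 1 / 2) :
    ‖lambertSeries q l - l‖ ≤ 2 * q * ‖l‖ + 12 * ‖l‖ ^ 2 := by
  have h1 := hasSum_lambertSeries hq0 hq (hl.trans_lt (by norm_num))
  rw [← hasSum_nat_add_iff' 1] at h1
  simp only [Finset.range_one, Finset.sum_singleton] at h1
  -- `12 = ∑ 2 (k + 2) / 2ᵏ`.
  have hnum : HasSum (fun k : ℕ => 2 * ((k : ℝ) + 2) * (1 / 2) ^ k * ‖l‖ ^ 2) (12 * ‖l‖ ^ 2) := by
    have h2 := hasSum_coe_mul_geometric_of_norm_lt_one (𝕜 := ℝ) (r := 1 / 2) (by norm_num)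
    have h3 := hasSum_geometric_of_lt_one (r := (1 / 2 : ℝ)) (by norm_num) (by norm_num)
    convert! ((h2.mul_left 2).add (h3.mul_left 4)).mul_right (‖l‖ ^ 2) using 1
    · funext k; ring
    · norm_num
  have h4 := h1.norm_le_of_bounded hnum fun k => by
    refine (norm_lambertCoeff_mul_pow_le hq0 hq (k + 1) le_rfl (k + 1 + 1)).trans ?_
    have h5 : ‖l‖ ^ k ≤ (1 / 2) ^ k := by gcongr
    push_cast
    calc 2 * ((k : ℝ) + 1 + 1) * ‖l‖ ^ (k + 1 + 1) = 2 * ((k : ℝ) + 2) * ‖l‖ ^ k * ‖l‖ ^ 2 := by ring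
      _ ≤ _ := by gcongr
  have h6 : ‖(lambertCoeff q 0 : ℂ) * l ^ (0 + 1) - l‖ ≤ 2 * q * ‖l‖ := by
    have h7 : (lambertCoeff q 0 : ℂ) * l ^ (0 + 1) - l = ((q / (1 - q) : ℝ) : ℂ) * l := by
      have : lambertCoeff q 0 - 1 = q / (1 - q) := by
        have : 1 - q ≠ 0 := by linarith
        rw [lambertCoeff, Nat.cast_zero, zero_add, pow_one]
        field_simp
        ring
      rw [← this]
      push_cast
      ring
    rw [h7, norm_mul, Complex.norm_real, Real.norm_of_nonneg (div_nonneg hq0 (by linarith))]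
    gcongr
    rw [div_le_iff₀ (by linarith)]
    nlinarith
  calc _ = ‖((lambertCoeff q 0 : ℂ) * l ^ (0 + 1) - l) +
        (lambertSeries q l - (lambertCoeff q 0 : ℂ) * l ^ (0 + 1))‖ := by congr 1; ring
    _ ≤ _ := norm_add_le _ _
    _ ≤ _ := add_le_add h6 h4

/-- Far from both ends of the annulus, `annulusTheta q c l` is close to `c + l`. -/
theorem norm_annulusTheta_sub_le {q c : ℝ} (hq0 : 0 ≤ q) (hq : q ≤ 1 / 2) {l : ℂ}
    (hl : ‖l‖ ≤ 1 / 2) (hql : 2 * q ≤ ‖l‖) (hl0 : 0 < ‖l‖) :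
    ‖annulusTheta q c l - (c + l)‖ ≤ 2 * q * ‖l‖ + 12 * ‖l‖ ^ 2 + 8 * (q / ‖l‖) := by
  have hn : ‖(q : ℂ) / l‖ = q / ‖l‖ := by
    rw [norm_div, Complex.norm_real, Real.norm_of_nonneg hq0]
  have hy : q / ‖l‖ ≤ 1 / 2 := by
    rw [div_le_iff₀ hl0]; linarith
  have hy0 : 0 ≤ q / ‖l‖ := by positivity
  have h1 := norm_lambertSeries_sub_le hq0 hq hl
  have h2 := norm_lambertSeries_sub_le hq0 hq (l := q / l) (by rw [hn]; exact hy)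
  rw [hn] at h2
  have h3 : ‖lambertSeries q (q / l)‖ ≤ 8 * (q / ‖l‖) := by
    have h4 := norm_add_le (lambertSeries q (q / l) - q / l) (q / l)
    rw [sub_add_cancel, hn] at h4
    nlinarith
  calc _ = ‖(lambertSeries q l - l) + lambertSeries q (q / l)‖ := by
        rw [annulusTheta]; congr 1; ring
    _ ≤ _ := norm_add_le _ _
    _ ≤ _ := add_le_add h1 h3

theorem annulusTheta_differentiableAt {q c : ℝ} (hq0 : 0 ≤ q) (hq : q ≤ 1 / 2) {l : ℂ}
    (hl : ‖l‖ < 1 / 2) (hql : 2 * q < ‖l‖) :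
    DifferentiableAt ℂ (annulusTheta q c) l := by
  have hl0 : 0 < ‖l‖ := by linarith
  have hS : ∀ m : ℂ, ‖m‖ < 1 / 2 → DifferentiableAt ℂ (lambertSeries q) m := fun m hm =>
    (lambertSeries_differentiableOn hq0 hq).differentiableAt
      (isOpen_ball.mem_nhds (mem_ball_zero_iff.2 hm))
  have h1 : DifferentiableAt ℂ (fun m : ℂ => (q : ℂ) / m) l :=
    (differentiableAt_const _).div differentiableAt_id (norm_pos_iff.1 hl0)
  have h2 : ‖(q : ℂ) / l‖ < 1 / 2 := by
    rw [norm_div, Complex.norm_real, Real.norm_of_nonneg hq0, div_lt_iff₀ hl0]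
    linarith
  exact ((differentiableAt_const _).add (hS l hl)).add ((hS _ h2).comp l h1)

theorem annulusTheta_ofReal_im (q c x : ℝ) : (annulusTheta q c x).im = 0 := by
  have h : ∀ y : ℝ, lambertSeries q y = ((∑' k : ℕ, lambertCoeff q k * y ^ (k + 1) : ℝ) : ℂ) := by
    intro y
    rw [lambertSeries, Complex.ofReal_tsum]
    refine tsum_congr fun k => ?_
    push_cast
    rfl
  rw [annulusTheta, ← Complex.ofReal_div, h, h]
  simp only [Complex.add_im, Complex.ofReal_im, add_zero]

/-- The Bergman kernel of the annulus in terms of `annulusTheta`. -/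
theorem bergmanKernel_annulus {r : ℝ} (hr : 0 < r) (hr2 : r ^ 2 ≤ 1 / 2) {z w : ℂ}
    (hz : z ∈ annulus r) (hw : w ∈ annulus r) :
    bergmanKernel (annulus r) z w =
      annulusTheta (r ^ 2) (1 / (2 * -Real.log r)) (z * (starRingEnd ℂ) w) /
        (π * (z * (starRingEnd ℂ) w)) := by
  have hr1 : r < 1 := by nlinarith
  have hπ : (π : ℂ) ≠ 0 := by exact_mod_cast Real.pi_ne_zero
  have hz0 := hr.trans hz.1
  have hw0 := hr.trans hw.1
  set l := z * (starRingEnd ℂ) w with hl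
  have hnl : ‖l‖ = ‖z‖ * ‖w‖ := by rw [hl, norm_mul, RCLike.norm_conj]
  have hl1 : ‖l‖ < 1 := by
    rw [hnl]; exact mul_lt_one_of_nonneg_of_lt_one_left hz0.le hz.2 hw.2.le
  have hlr : r ^ 2 < ‖l‖ := by
    rw [hnl, sq]; exact mul_lt_mul'' hz.1 hw.1 hr.le hr.le
  have hl0 : l ≠ 0 := norm_pos_iff.1 ((sq_nonneg r).trans_lt hlr)
  set q : ℝ := r ^ 2 with hq
  have hq0 : 0 < q := by positivity
  have hql : ‖(q : ℂ) / l‖ < 1 := by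
    rw [norm_div, Complex.norm_real, Real.norm_of_nonneg hq0.le,
      div_lt_one (norm_pos_iff.2 hl0)]
    exact hlr
  have hqk : ∀ k : ℕ, 1 - (q : ℂ) ^ (k + 1) ≠ 0 := fun k h => by
    have h1 : q ^ (k + 1) < 1 := pow_lt_one₀ hq0.le (by linarith) k.succ_ne_zero
    have h2 : (1 - q ^ (k + 1) : ℝ) = 0 := by exact_mod_cast h
    linarith
  have hk1 : ∀ k : ℕ, (k : ℂ) + 1 ≠ 0 := fun k => by exact_mod_cast k.succ_ne_zero
  have hlog : Real.log r ≠ 0 := (Real.log_neg hr hr1).ne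
  have hpos : HasSum (fun n : ℕ => l ^ (n : ℤ) / (2 * π * radialMoment r n))
      (lambertSeries q l / (π * l)) := by
    refine ((hasSum_lambertSeries hq0.le hr2 hl1).div_const (π * l)).congr_fun fun k => ?_
    have h1 := radialMoment_sub_one hr hr1 (k := k + 1) (by omega)
    rw [add_sub_cancel_right] at h1
    have h2 : (r ^ 2) ^ ((k : ℤ) + 1) = q ^ (k + 1) := by rw [hq]; norm_cast
    rw [h1, h2, lambertCoeff, zpow_natCast]
    push_cast
    have := hqk k
    have := hk1 k
    field_simp
    ring
  -- The index `-1` gives the constant `1 / (2 log (1 / r))`, the indices below it the powers of `q / l`.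
  have hneg : HasSum (fun n : ℕ => l ^ (-((n : ℤ) + 1)) / (2 * π * radialMoment r (-((n : ℤ) + 1))))
      ((lambertSeries q (q / l) + (1 / (2 * -Real.log r) : ℝ)) / (π * l)) := by
    rw [← hasSum_nat_add_iff' 1]
    simp only [Finset.range_one, Finset.sum_singleton]
    have h0 : l ^ (-(((0 : ℕ) : ℤ) + 1)) / (2 * π * radialMoment r (-(((0 : ℕ) : ℤ) + 1))) =
        ((1 / (2 * -Real.log r) : ℝ) : ℂ) / (π * l) := by
      have hlog' : (Real.log r : ℂ) ≠ 0 := by exact_mod_cast hlog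
      rw [Nat.cast_zero, zero_add, radialMoment_neg_one hr, zpow_neg_one]
      push_cast
      field_simp
    rw [h0, add_div, add_sub_cancel_right]
    refine ((hasSum_lambertSeries hq0.le hr2 hql).div_const (π * l)).congr_fun fun k => ?_
    have h1 := radialMoment_sub_one hr hr1 (k := -((k : ℤ) + 1)) (by omega)
    have h2 : -((k : ℤ) + 1) - 1 = -(((k + 1 : ℕ) : ℤ) + 1) := by push_cast; ring
    have h3 : (r ^ 2) ^ (-((k : ℤ) + 1)) = (q ^ (k + 1))⁻¹ := by
      rw [zpow_neg, hq]; norm_cast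
    have h4 : l ^ (-(((k + 1 : ℕ) : ℤ) + 1)) = (l ^ (k + 1))⁻¹ * l⁻¹ := by
      rw [zpow_neg, ← mul_inv, ← pow_succ]; norm_cast
    rw [h2, h3] at h1
    rw [h1, h4, lambertCoeff, div_pow]
    have hq' : (q : ℂ) ^ (k + 1) ≠ 0 := pow_ne_zero _ (by exact_mod_cast hq0.ne')
    have h5 : (1 - ((q : ℂ) ^ (k + 1))⁻¹) = -(1 - (q : ℂ) ^ (k + 1)) / (q : ℂ) ^ (k + 1) := by
      field_simp
      ring
    push_cast
    rw [h5]
    have := hqk k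
    have := hk1 k
    have h6 := pow_ne_zero (k + 1) hl0
    have h7 : (-1 + -(k : ℂ)) ≠ 0 := fun h => this (by linear_combination -h)
    field_simp
  have hK := hasSum_bergmanKernel_annulus hr hr1 hz hw
  rw [← hl] at hK
  rw [hK.unique (HasSum.of_nat_of_neg_add_one
    (f := fun n : ℤ => l ^ n / (2 * π * radialMoment r n)) hpos hneg), annulusTheta]
  ring

/-! ### The Bergman metric and the length of a half ellipse -/

theorem hasFDerivAt_comp_norm_sq {f : ℝ → ℝ} {f' : ℝ} {z : ℂ} (h : HasDerivAt f f' (‖z‖ ^ 2)) :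
    HasFDerivAt (fun w : ℂ => (f (‖w‖ ^ 2) : ℂ))
      (Complex.ofRealCLM.comp (f' • (2 • innerSL ℝ z))) z :=
  Complex.ofRealCLM.hasFDerivAt.comp z (h.comp_hasFDerivAt z (hasStrictFDerivAt_norm_sq z).hasFDerivAt)

/-- The complex Laplacian of a radial function, in terms of the variable `t = |z|²`. -/
theorem wirtingerDz_wirtingerDzBar_radial {u : ℂ → ℂ} {f f' : ℝ → ℝ} {f'' : ℝ} {z : ℂ}
    (hu : ∀ᶠ w in 𝓝 z, u w = f (‖w‖ ^ 2))
    (hf : ∀ᶠ w in 𝓝 z, HasDerivAt f (f' (‖w‖ ^ 2)) (‖w‖ ^ 2))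
    (hf' : HasDerivAt f' f'' (‖z‖ ^ 2)) :
    wirtingerDz (wirtingerDzBar u) z = ((f' (‖z‖ ^ 2) + ‖z‖ ^ 2 * f'' : ℝ) : ℂ) := by
  -- `∂̄` of a radial function `f(|w|²)` is `f'(|w|²) w`.
  have h1 : wirtingerDzBar u =ᶠ[𝓝 z] fun w => (f' (‖w‖ ^ 2) : ℂ) * w := by
    filter_upwards [hu.eventually_nhds, hf] with w hw1 hw2
    have h2 : fderiv ℝ u w = _ :=
      (Filter.EventuallyEq.fderiv_eq hw1).trans (hasFDerivAt_comp_norm_sq hw2).fderiv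
    rw [wirtingerDzBar, h2]
    simp only [ContinuousLinearMap.comp_apply, _root_.smul_apply,
      Complex.ofRealCLM_apply, innerSL_apply_apply, Complex.inner, smul_eq_mul, nsmul_eq_mul]
    apply Complex.ext <;> simp <;> ring
  have h3 : HasFDerivAt (fun w => (f' (‖w‖ ^ 2) : ℂ) * w) _ z :=
    (hasFDerivAt_comp_norm_sq hf').mul (hasFDerivAt_id (𝕜 := ℝ) z)
  rw [wirtingerDz, h1.fderiv_eq, h3.fderiv]
  have h4 : ‖z‖ ^ 2 = z.re * z.re + z.im * z.im := by
    rw [Complex.sq_norm, Complex.normSq_apply]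
  rw [h4]
  simp only [ContinuousLinearMap.comp_apply, _root_.smul_apply,
    _root_.add_apply, ContinuousLinearMap.id_apply,
    Complex.ofRealCLM_apply, innerSL_apply_apply, Complex.inner, smul_eq_mul, nsmul_eq_mul]
  apply Complex.ext <;> simp <;> ring

/-- The Bergman metric of the annulus in terms of `θ = annulusTheta` and its derivatives at `|z|²`. -/
theorem bergmanMetricCoeff_annulus {r : ℝ} (hr : 0 < r) (hr2 : r ^ 2 ≤ 1 / 2) {z : ℂ} {t : ℝ}
    (ht : ‖z‖ ^ 2 = t) (ht1 : 2 * r ^ 2 < t) (ht2 : t < 1 / 2) {θ : ℂ → ℂ}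
    (hθ : θ = annulusTheta (r ^ 2) (1 / (2 * -Real.log r))) (hpos : 0 < (θ t).re) :
    bergmanMetricCoeff (annulus r) z =
      ((θ t).re * ((deriv θ t).re + t * (deriv (deriv θ) t).re) - t * (deriv θ t).re ^ 2) /
        (θ t).re ^ 2 := by
  set U : Set ℂ := {l | 2 * r ^ 2 < ‖l‖ ∧ ‖l‖ < 1 / 2} with hU
  have hUo : IsOpen U := (isOpen_lt continuous_const continuous_norm).inter
    (isOpen_lt continuous_norm continuous_const)
  have hd : DifferentiableOn ℂ θ U := fun l hl => by
    rw [hθ]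
    exact (annulusTheta_differentiableAt (sq_nonneg r) hr2 hl.2 hl.1).differentiableWithinAt
  have hd' : DifferentiableOn ℂ (deriv θ) U := hd.deriv hUo
  have hmem : ∀ x : ℝ, 2 * r ^ 2 < x → x < 1 / 2 → (x : ℂ) ∈ U := fun x h1 h2 => by
    have : ‖(x : ℂ)‖ = x := by
      rw [Complex.norm_real, Real.norm_of_nonneg (by nlinarith [sq_nonneg r])]
    rw [hU, Set.mem_ofPred_eq, this]
    exact ⟨h1, h2⟩
  have hB : ∀ x : ℝ, 2 * r ^ 2 < x → x < 1 / 2 →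
      HasDerivAt (fun y : ℝ => (θ y).re) (deriv θ x).re x := fun x h1 h2 =>
    (hd.differentiableAt (hUo.mem_nhds (hmem x h1 h2))).hasDerivAt.real_of_complex
  have hB' : ∀ x : ℝ, 2 * r ^ 2 < x → x < 1 / 2 →
      HasDerivAt (fun y : ℝ => (deriv θ y).re) (deriv (deriv θ) x).re x := fun x h1 h2 =>
    (hd'.differentiableAt (hUo.mem_nhds (hmem x h1 h2))).hasDerivAt.real_of_complex
  have hcont : Continuous fun w : ℂ => ‖w‖ ^ 2 := by fun_prop
  have ht0 : 0 < t := by nlinarith [sq_nonneg r]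
  have hnear : ∀ᶠ w in 𝓝 z, (2 * r ^ 2 < ‖w‖ ^ 2 ∧ ‖w‖ ^ 2 < 1 / 2) ∧ 0 < (θ (‖w‖ ^ 2 : ℝ)).re := by
    have h1 : ∀ᶠ x in 𝓝 t, (2 * r ^ 2 < x ∧ x < 1 / 2) ∧ 0 < (θ (x : ℝ)).re :=
      ((lt_mem_nhds ht1).and (gt_mem_nhds ht2)).and
        ((hB t ht1 ht2).continuousAt.eventually (lt_mem_nhds hpos))
    rw [← ht] at h1
    exact hcont.continuousAt.eventually h1
  have hf : ∀ x : ℝ, 2 * r ^ 2 < x → x < 1 / 2 → 0 < (θ x).re →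
      HasDerivAt (fun y : ℝ => Real.log (θ y).re - Real.log (π * y))
        ((deriv θ x).re / (θ x).re - x⁻¹) x := fun x h1 h2 h3 => by
    have hx : 0 < x := by nlinarith [sq_nonneg r]
    have h4 := (hasDerivAt_id x).const_mul π
    convert! ((hB x h1 h2).log h3.ne').sub (h4.log (by simp [hx.ne', Real.pi_ne_zero])) using 1
    simp only [id]
    field_simp
  have hf' : HasDerivAt (fun x : ℝ => (deriv θ x).re / (θ x).re - x⁻¹)
      (((deriv (deriv θ) t).re * (θ t).re - (deriv θ t).re * (deriv θ t).re) / (θ t).re ^ 2 -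
        -(t ^ 2)⁻¹) t :=
    ((hB' t ht1 ht2).div (hB t ht1 ht2) hpos.ne').sub (hasDerivAt_inv ht0.ne')
  rw [bergmanMetricCoeff, wirtingerDz_wirtingerDzBar_radial
    (f := fun y : ℝ => Real.log (θ y).re - Real.log (π * y)) ?_ ?_ (ht ▸ hf'),
    Complex.ofReal_re, ht]
  · have := hpos.ne'
    field_simp
    ring
  · filter_upwards [hnear] with w hw
    have hw0 : 0 < ‖w‖ ^ 2 := by nlinarith [sq_nonneg r]
    have hwm : w ∈ annulus r := by
      refine ⟨lt_of_pow_lt_pow_left₀ 2 (norm_nonneg w) (by nlinarith [sq_nonneg r]), ?_⟩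
      nlinarith [norm_nonneg w]
    congr 1
    rw [bergmanKernel_annulus hr hr2 hwm hwm, ← hθ, Complex.mul_conj', ← Complex.ofReal_pow,
      ← Complex.ofReal_mul, Complex.div_ofReal_re,
      Real.log_div hw.2.ne' (mul_pos Real.pi_pos hw0).ne']
  · filter_upwards [hnear] with w hw
    exact hf _ hw.1.1 hw.1.2 hw.2

/-- If `θ` is relatively `δ`-close to `c + l` on a neighbourhood of `t`, then the logarithmic
Laplacian of `θ` is close to `c / (c + t)²`, the one of `c + l`. Cauchy's estimates transfer the
closeness to the derivatives. -/
theorem log_laplacian_le {θ : ℂ → ℂ} {c t δ : ℝ} (ht : 0 < t) (htc : t ≤ 2 * c) (hδ0 : 0 ≤ δ)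
    (hδ : δ < 1 / 3) (hd : DifferentiableOn ℂ θ (closedBall (t : ℂ) (t / 2)))
    (hb : ∀ l ∈ closedBall (t : ℂ) (t / 2), ‖θ l - (c + l)‖ ≤ δ * ‖l‖) :
    0 < (θ t).re ∧
    ((θ t).re * ((deriv θ t).re + t * (deriv (deriv θ) t).re) - t * (deriv θ t).re ^ 2) /
        (θ t).re ^ 2 ≤ (1 + 100 * δ) / (1 - δ) ^ 2 * (c / (c + t) ^ 2) := by
  have hc : 0 < c := by linarith
  have hR : 0 < t / 2 := by positivity
  set E : ℂ → ℂ := fun l => θ l - (c + l) with hE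
  have hlin : Differentiable ℂ fun l : ℂ => (c : ℂ) + l := by fun_prop
  have hEd : DifferentiableOn ℂ E (closedBall (t : ℂ) (t / 2)) := hd.sub hlin.differentiableOn
  have hEc : DiffContOnCl ℂ E (ball (t : ℂ) (t / 2)) :=
    (hEd.mono closure_ball_subset_closedBall).diffContOnCl
  have hnt : ‖(t : ℂ)‖ = t := by rw [Complex.norm_real, Real.norm_of_nonneg ht.le]
  have hEb : ∀ l ∈ sphere (t : ℂ) (t / 2), ‖E l‖ ≤ δ * (3 * t / 2) := fun l hl => by
    refine (hb l (sphere_subset_closedBall hl)).trans ?_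
    have h1 := norm_add_le (l - t) (t : ℂ)
    rw [sub_add_cancel, hnt, mem_sphere_iff_norm.1 hl] at h1
    gcongr
    linarith
  have h0 : ‖E t‖ ≤ δ * t := by
    have := hb t (mem_closedBall_self hR.le)
    rwa [hnt] at this
  have h1 : ‖deriv E t‖ ≤ 3 * δ := by
    refine (Complex.norm_deriv_le_of_forall_mem_sphere_norm_le hR hEc hEb).trans_eq ?_
    field_simp
  have h2 : ‖deriv (deriv E) t‖ ≤ 12 * δ / t := by
    have h3 := Complex.norm_iteratedDeriv_le_of_forall_mem_sphere_norm_le 2 hR hEc hEb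
    rw [iteratedDeriv_succ, iteratedDeriv_one] at h3
    refine h3.trans_eq ?_
    norm_num [Nat.factorial]
    field_simp
    ring
  have hdE : ∀ l ∈ ball (t : ℂ) (t / 2), deriv E l = deriv θ l - 1 := fun l hl => by
    have h4 : DifferentiableAt ℂ θ l :=
      (hd.mono ball_subset_closedBall).differentiableAt (isOpen_ball.mem_nhds hl)
    refine (h4.hasDerivAt.sub ?_).deriv
    exact (hasDerivAt_id l).const_add (c : ℂ)
  have hdE0 := hdE t (mem_ball_self hR)
  have hddE : deriv (deriv E) t = deriv (deriv θ) t := by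
    have h5 : deriv E =ᶠ[𝓝 (t : ℂ)] fun l => deriv θ l - 1 :=
      Filter.eventuallyEq_of_mem (ball_mem_nhds _ hR) hdE
    rw [h5.deriv_eq, deriv_sub_const]
  rw [hdE0] at h1
  rw [hddE] at h2
  have e0 := abs_le.1 ((Complex.abs_re_le_norm _).trans h0)
  have e1 := abs_le.1 ((Complex.abs_re_le_norm _).trans h1)
  have e2 := (le_abs_self _).trans ((Complex.abs_re_le_norm _).trans h2)
  simp only [hE, Complex.sub_re, Complex.add_re, Complex.ofReal_re, Complex.one_re] at e0 e1
  rw [le_div_iff₀ ht] at e2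
  set B := (θ t).re
  set B' := (deriv θ t).re
  set B'' := (deriv (deriv θ) t).re
  have hBlow : (1 - δ) * (c + t) ≤ B := by nlinarith
  have hBhigh : B ≤ c + t * (1 + δ) := by linarith
  have hlow : 0 < (1 - δ) * (c + t) := mul_pos (by linarith) (by linarith)
  have hB : 0 < B := hlow.trans_le hBlow
  refine ⟨hB, ?_⟩
  have hnum : B * (B' + t * B'') - t * B' ^ 2 ≤ c * (1 + 100 * δ) := by
    have h6 : B * (B' + t * B'') ≤ (c + t * (1 + δ)) * (1 + 15 * δ) :=
      (mul_le_mul_of_nonneg_left (by linarith) hB.le).trans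
        (mul_le_mul_of_nonneg_right hBhigh (by linarith))
    have h7 : t * (1 - 6 * δ) ≤ t * B' ^ 2 := by
      have : (1 - 3 * δ) ^ 2 ≤ B' ^ 2 := by
        have : 0 ≤ 1 - 3 * δ := by linarith
        gcongr
        linarith
      gcongr
      nlinarith
    have h8 : t * δ ≤ 2 * c * δ := by gcongr
    nlinarith [mul_nonneg (mul_nonneg ht.le hδ0) hδ0, mul_nonneg ht.le hδ0]
  calc _ ≤ c * (1 + 100 * δ) / B ^ 2 := by gcongr
    _ ≤ c * (1 + 100 * δ) / ((1 - δ) * (c + t)) ^ 2 := by gcongr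
    _ = _ := by rw [mul_pow, div_mul_div_comm, mul_comm c]

/-- The Bergman length of the half ellipse from `-a` to `a` with semi-axes `a` and `h`, when the
Bergman metric is at most `M` times the Fubini-Study metric of the coordinate `z / √c`. -/
theorem bergmanDist_le_of_metric_le {Ω : TopologicalSpace.Opens ℂ} {a h c M : ℝ} (h0 : 0 ≤ h)
    (hha : h ≤ a) (hc : 0 < c) (hM : 0 ≤ M)
    (hΩ : ∀ z : ℂ, h ≤ ‖z‖ → ‖z‖ ≤ a →
      z ∈ Ω ∧ bergmanMetricCoeff Ω z ≤ M * (c / (c + ‖z‖ ^ 2) ^ 2)) :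
    bergmanDist Ω (-a : ℝ) a ≤ ENNReal.ofReal (√M * (2 * Real.arctan (a / √c) + π * h / √c)) := by
  have ha : 0 ≤ a := h0.trans hha
  have hsc : 0 < √c := Real.sqrt_pos.2 hc
  have hsc2 : √c ^ 2 = c := Real.sq_sqrt hc.le
  set γ : ℝ → ℂ := fun t => (-a * Real.cos (π * t) : ℝ) + (h * Real.sin (π * t) : ℝ) * Complex.I
    with hγ
  have hd : ∀ t, HasDerivAt γ
      ((a * (π * Real.sin (π * t)) : ℝ) + (h * (π * Real.cos (π * t)) : ℝ) * Complex.I) t := by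
    intro t
    have h1 : HasDerivAt (fun t : ℝ => π * t) π t := by
      simpa using (hasDerivAt_id t).const_mul π
    have h2 : HasDerivAt (fun t : ℝ => -a * Real.cos (π * t)) (a * (π * Real.sin (π * t))) t := by
      convert! h1.cos.const_mul (-a) using 1
      ring
    have h3 : HasDerivAt (fun t : ℝ => h * Real.sin (π * t)) (h * (π * Real.cos (π * t))) t := by
      convert! h1.sin.const_mul h using 1
      ring
    exact h2.ofReal_comp.add (h3.ofReal_comp.mul_const Complex.I)
  have hnorm : ∀ x y : ℝ, ‖(x : ℂ) + y * Complex.I‖ ^ 2 = x ^ 2 + y ^ 2 := fun x y => by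
    rw [Complex.sq_norm, Complex.normSq_add_mul_I]
  have hγn : ∀ t, ‖γ t‖ ^ 2 = a ^ 2 * Real.cos (π * t) ^ 2 + h ^ 2 * Real.sin (π * t) ^ 2 := by
    intro t
    rw [hγ, hnorm]
    ring
  have hlow : ∀ t, h ≤ ‖γ t‖ := fun t => by
    refine le_of_sq_le_sq ?_ (norm_nonneg _)
    rw [hγn]
    have : h ^ 2 ≤ a ^ 2 := by gcongr
    nlinarith [Real.sin_sq_add_cos_sq (π * t), sq_nonneg (Real.cos (π * t))]
  have hhigh : ∀ t, ‖γ t‖ ≤ a := fun t => by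
    refine le_of_sq_le_sq ?_ ha
    rw [hγn]
    have : h ^ 2 ≤ a ^ 2 := by gcongr
    nlinarith [Real.sin_sq_add_cos_sq (π * t), sq_nonneg (Real.sin (π * t))]
  have hadm : IsPiecewiseC1 γ ∧ (∀ t ∈ Set.Icc (0 : ℝ) 1, γ t ∈ Ω) ∧ γ 0 = (-a : ℝ) ∧ γ 1 = a := by
    refine ⟨⟨1, ![0, 1], ?_, rfl, rfl, fun i => ?_⟩, fun t _ => (hΩ _ (hlow t) (hhigh t)).1, ?_, ?_⟩
    · intro i j hij
      fin_cases i <;> fin_cases j <;> simp_all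
    · refine ContDiff.contDiffOn ?_
      have h1 : ContDiff ℝ 1 fun t : ℝ => Complex.ofRealCLM (-a * Real.cos (π * t)) :=
        Complex.ofRealCLM.contDiff.comp (by fun_prop)
      have h2 : ContDiff ℝ 1 fun t : ℝ => Complex.ofRealCLM (h * Real.sin (π * t)) :=
        Complex.ofRealCLM.contDiff.comp (by fun_prop)
      exact h1.add (h2.mul contDiff_const)
    · simp [hγ]
    · simp [hγ]
  refine (iInf₂_le γ hadm).trans ?_
  set g : ℝ → ℝ := fun t =>
    √M * (√c * a * π * Real.sin (π * t) / (c + a ^ 2 * Real.cos (π * t) ^ 2) + π * h / √c) with hg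
  have hden : ∀ t, 0 < c + a ^ 2 * Real.cos (π * t) ^ 2 := fun t => by positivity
  have hgc : Continuous g := by
    refine continuous_const.mul ((Continuous.div (by fun_prop) (by fun_prop) fun t => ?_).add
      continuous_const)
    exact (hden t).ne'
  have hsin : ∀ t ∈ Set.Icc (0 : ℝ) 1, 0 ≤ Real.sin (π * t) := fun t ht =>
    Real.sin_nonneg_of_nonneg_of_le_pi (mul_nonneg Real.pi_pos.le ht.1)
      (mul_le_of_le_one_right Real.pi_pos.le ht.2)
  have hg0 : ∀ t ∈ Set.Icc (0 : ℝ) 1, 0 ≤ g t := fun t ht => by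
    have := hsin t ht
    have := hden t
    positivity
  have hle : ∀ t ∈ Set.Icc (0 : ℝ) 1, bergmanNorm Ω (γ t) (deriv γ t) ≤ g t := by
    intro t ht
    have hs := hsin t ht
    have hX : ‖deriv γ t‖ ≤ a * (π * Real.sin (π * t)) + h * π := by
      rw [(hd t).deriv]
      refine (norm_add_le _ _).trans ?_
      rw [norm_mul, Complex.norm_I, mul_one, Complex.norm_real, Complex.norm_real,
        Real.norm_of_nonneg (by positivity), Real.norm_eq_abs, abs_mul, abs_mul, abs_of_nonneg h0,
        abs_of_pos Real.pi_pos]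
      have := mul_le_of_le_one_right Real.pi_pos.le (Real.abs_cos_le_one (π * t))
      gcongr
    have hT := (hΩ _ (hlow t) (hhigh t)).2
    have hγ2 : a ^ 2 * Real.cos (π * t) ^ 2 ≤ ‖γ t‖ ^ 2 := by
      rw [hγn]
      nlinarith [mul_nonneg (sq_nonneg h) (sq_nonneg (Real.sin (π * t)))]
    calc bergmanNorm Ω (γ t) (deriv γ t)
        ≤ √(M * (c / (c + ‖γ t‖ ^ 2) ^ 2) * ‖deriv γ t‖ ^ 2) := by
          rw [bergmanNorm]; gcongr
      _ = √M * (√c / (c + ‖γ t‖ ^ 2) * ‖deriv γ t‖) := by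
          rw [Real.sqrt_mul' _ (by positivity), Real.sqrt_mul hM, Real.sqrt_div hc.le,
            Real.sqrt_sq (by positivity), Real.sqrt_sq (by positivity), mul_assoc]
      _ ≤ √M * (√c / (c + ‖γ t‖ ^ 2) * (a * (π * Real.sin (π * t)) + h * π)) := by gcongr
      _ = √M * (√c * a * π * Real.sin (π * t) / (c + ‖γ t‖ ^ 2) +
            √c * (π * h) / (c + ‖γ t‖ ^ 2)) := by ring
      _ ≤ √M * (√c * a * π * Real.sin (π * t) / (c + a ^ 2 * Real.cos (π * t) ^ 2) +
            √c * (π * h) / c) := by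
          have := hden t
          gcongr
          nlinarith [sq_nonneg ‖γ t‖]
      _ = g t := by
          simp only [hg]
          congr 2
          nth_rewrite 2 [← hsc2]
          field_simp
  -- The main term of `g` has the primitive `-arctan ((a / √c) cos (π t))`.
  have hint : ∫ t in Set.Icc (0 : ℝ) 1, g t = √M * (2 * Real.arctan (a / √c) + π * h / √c) := by
    have hder : ∀ t, HasDerivAt
        (fun t => √M * (-Real.arctan (a / √c * Real.cos (π * t)) + π * h / √c * t)) (g t) t := by
      intro t
      have h1 : HasDerivAt (fun t : ℝ => π * t) π t := by
        simpa using (hasDerivAt_id t).const_mul π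
      have h2 := (h1.cos.const_mul (a / √c)).arctan.neg.add
        ((hasDerivAt_id t).const_mul (π * h / √c))
      convert! h2.const_mul (√M) using 1
      simp only [hg]
      congr 2
      · have h3 : 1 + (a / √c * Real.cos (π * t)) ^ 2 =
            (c + a ^ 2 * Real.cos (π * t) ^ 2) / (√c * √c) := by
          rw [mul_pow, div_pow, hsc2, ← sq, hsc2]
          field_simp
        rw [h3]
        have := (hden t).ne'
        field_simp
      · simp
    rw [integral_Icc_eq_integral_Ioc, ← intervalIntegral.integral_of_le zero_le_one,
      intervalIntegral.integral_eq_sub_of_hasDerivAt (fun t _ => hder t)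
        (hgc.intervalIntegrable _ _)]
    simp [Real.arctan_neg]
    ring
  rw [bergmanLength, ← hint, ofReal_integral_eq_lintegral_ofReal hgc.integrableOn_Icc
    ((ae_restrict_iff' measurableSet_Icc).2 (ae_of_all _ hg0))]
  exact setLIntegral_mono' measurableSet_Icc fun t ht => ENNReal.ofReal_le_ofReal (hle t ht)

/-! ### Zeros of the kernel of an annulus with small inner radius -/

theorem annulus_isConnected {r : ℝ} (hr : 0 ≤ r) (hr1 : r < 1) :
    IsConnected (annulus r : Set ℂ) := by
  have h : (annulus r : Set ℂ) =
      (fun p : ℝ × ℝ => circleMap 0 p.1 p.2) '' (Set.Ioo r 1 ×ˢ Set.univ) := by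
    ext z
    constructor
    · intro hz
      refine ⟨(‖z‖, Complex.arg z), ⟨hz, trivial⟩, ?_⟩
      simp [circleMap, Complex.norm_mul_exp_arg_mul_I]
    · rintro ⟨⟨ρ, θ⟩, ⟨hρ, -⟩, rfl⟩
      rw [SetLike.mem_coe, mem_annulus, norm_circleMap_zero, abs_of_pos (hr.trans_lt hρ.1)]
      exact hρ
  rw [h]
  refine ((isConnected_Ioo hr1).prod isConnected_univ).image _ (Continuous.continuousOn ?_)
  unfold circleMap
  fun_prop

theorem annulus_isBounded (r : ℝ) : Bornology.IsBounded (annulus r : Set ℂ) :=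
  isBounded_ball.subset fun _ hz => mem_ball_zero_iff.2 hz.2

/-- The scalar inequalities that make `annulusTheta` relatively `δ`-close to `c + l` and the turn at
radius `1 / L` shorter than `δ`, for the annulus of inner radius `r = exp (-L)`. -/
theorem eventually_annulus_parameters {δ : ℝ} (hδ : 0 < δ) :
    ∀ᶠ L : ℝ in atTop, 4 < L ∧ 4 * Real.exp (-(2 * L)) * L ^ 2 < 1 ∧
      2 * Real.exp (-(2 * L)) + 24 / L + 32 * Real.exp (-(2 * L)) * L ^ 4 ≤ δ ∧
      2 * π ^ 2 / L ≤ δ ^ 2 := by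
  have hexp : ∀ n : ℕ, Tendsto (fun L : ℝ => Real.exp (-(2 * L)) * L ^ n) atTop (𝓝 0) := fun n => by
    have h1 := (Real.tendsto_pow_mul_exp_neg_atTop_nhds_zero n).comp
      (tendsto_id.const_mul_atTop (two_pos : (0 : ℝ) < 2))
    have h2 := h1.const_mul ((2 : ℝ) ^ n)⁻¹
    rw [mul_zero] at h2
    refine h2.congr fun L => ?_
    simp only [Function.comp, id]
    rw [mul_pow]
    field_simp
  have hinv : ∀ a : ℝ, Tendsto (fun L : ℝ => a / L) atTop (𝓝 0) := fun a =>
    tendsto_const_nhds.div_atTop tendsto_id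
  have h2 : Tendsto (fun L : ℝ => 4 * (Real.exp (-(2 * L)) * L ^ 2)) atTop (𝓝 0) := by
    simpa using (hexp 2).const_mul 4
  have h3 : Tendsto (fun L : ℝ => 2 * (Real.exp (-(2 * L)) * L ^ 0) + 24 / L +
      32 * (Real.exp (-(2 * L)) * L ^ 4)) atTop (𝓝 0) := by
    simpa using (((hexp 0).const_mul 2).add (hinv 24)).add ((hexp 4).const_mul 32)
  filter_upwards [eventually_gt_atTop 4, h2.eventually (gt_mem_nhds one_pos),
    h3.eventually (ge_mem_nhds hδ),
    (hinv (2 * π ^ 2)).eventually (ge_mem_nhds (by positivity : 0 < δ ^ 2))] with L h4 h5 h6 h7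
  refine ⟨h4, by linarith, ?_, h7⟩
  rw [pow_zero, mul_one] at h6
  linarith

/-- The bound obtained for the distance tends to `2 arctan 1 = π / 2` as `δ → 0`. -/
theorem eventually_radius_bound {ε : ℝ} (hε : 0 < ε) :
    ∀ᶠ δ : ℝ in 𝓝 0, √((1 + 100 * δ) / (1 - δ) ^ 2) *
      (2 * Real.arctan (√(1 / (1 - δ))) + δ) < π / 2 + ε := by
  have hc : ContinuousAt (fun δ : ℝ => √((1 + 100 * δ) / (1 - δ) ^ 2) *
      (2 * Real.arctan (√(1 / (1 - δ))) + δ)) 0 := by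
    have h1 : ContinuousAt (fun δ : ℝ => (1 + 100 * δ) / (1 - δ) ^ 2) 0 :=
      ContinuousAt.div (by fun_prop) (by fun_prop) (by norm_num)
    have h2 : ContinuousAt (fun δ : ℝ => 1 / (1 - δ)) 0 :=
      ContinuousAt.div (by fun_prop) (by fun_prop) (by norm_num)
    exact h1.sqrt.mul (((Real.continuous_arctan.continuousAt.comp h2.sqrt).const_mul 2).add
      continuousAt_id)
  refine hc.eventually (gt_mem_nhds ?_)
  simp only [mul_zero, add_zero, sub_zero, one_pow, div_one, Real.sqrt_one, one_mul,
    Real.arctan_one]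
  linarith

/-- For small inner radius the kernel vanishes at a pair `(-a, a)` whose Bergman distance is at most
about `π / 2`. Here `δ` measures how far the Bergman metric is from the Fubini-Study metric of
`z / √c`, where `c = 1 / (2 log (1 / r))`, and also bounds the cost of going around the hole. -/
theorem exists_zero_bergmanKernel_annulus {r δ : ℝ} (hr : 0 < r) (hδ0 : 0 < δ) (hδ : δ < 1 / 3)
    (hL : 4 < -Real.log r) (hq2 : 4 * r ^ 2 * Real.log r ^ 2 < 1)
    (hqδ : 2 * r ^ 2 + 24 / -Real.log r + 32 * r ^ 2 * Real.log r ^ 4 ≤ δ)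
    (hπ : 2 * π ^ 2 / -Real.log r ≤ δ ^ 2) :
    ∃ a : ℝ, (a : ℂ) ∈ annulus r ∧ ((-a : ℝ) : ℂ) ∈ annulus r ∧
      bergmanKernel (annulus r) (-a : ℝ) a = 0 ∧
      bergmanDist (annulus r) (-a : ℝ) a ≤ ENNReal.ofReal (√((1 + 100 * δ) / (1 - δ) ^ 2) *
        (2 * Real.arctan (√(1 / (1 - δ))) + δ)) := by
  set L := -Real.log r with hLdef
  have hlog2 : Real.log r ^ 2 = L ^ 2 := by rw [hLdef, neg_sq]
  have hlog4 : Real.log r ^ 4 = L ^ 4 := by rw [hLdef]; ring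
  rw [hlog2] at hq2
  rw [hlog4] at hqδ
  have hL0 : 0 < L := by linarith
  set q := r ^ 2 with hq
  have hq0 : 0 < q := by positivity
  set c := 1 / (2 * L) with hc
  have hc0 : 0 < c := by positivity
  have hLc : 1 / L = 2 * c := by rw [hc]; field_simp
  have hq12 : q ≤ 1 / 2 := by nlinarith
  have hL4 : 1 / L < 1 / 4 := one_div_lt_one_div_of_lt (by norm_num) hL
  have hLL : (1 / L) ^ 2 ≤ 1 / L * (1 / 4) := by
    rw [sq]; gcongr
  have hiL0 : 0 < 1 / L := by positivity
  have hsq0 : 0 < (1 / L) ^ 2 := by positivity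
  have hqL : 4 * q < (1 / L) ^ 2 := by
    rw [div_pow, one_pow, lt_div_iff₀ (by positivity)]
    exact hq2
  set θ := annulusTheta q c with hθ
  have hreg : ∀ l : ℂ, (1 / L) ^ 2 / 2 ≤ ‖l‖ → ‖l‖ ≤ 3 / 2 * (1 / L) →
      DifferentiableAt ℂ θ l ∧ ‖θ l - (c + l)‖ ≤ δ * ‖l‖ := by
    intro l h1 h2
    have hl0 : 0 < ‖l‖ := lt_of_lt_of_le (by positivity) h1
    refine ⟨annulusTheta_differentiableAt hq0.le hq12 (by linarith) (by linarith),
      (norm_annulusTheta_sub_le hq0.le hq12 (by linarith) (by linarith) hl0).trans ?_⟩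
    have h3 : q / ‖l‖ ≤ 4 * q * L ^ 4 * ‖l‖ := by
      rw [div_le_iff₀ hl0]
      have h4 : ((1 / L) ^ 2 / 2) ^ 2 ≤ ‖l‖ ^ 2 := by gcongr
      have h5 : 4 * L ^ 4 * ((1 / L) ^ 2 / 2) ^ 2 = 1 := by field_simp; norm_num
      have h6 : 4 * L ^ 4 * ((1 / L) ^ 2 / 2) ^ 2 ≤ 4 * L ^ 4 * ‖l‖ ^ 2 := by gcongr
      rw [h5] at h6
      nlinarith
    have h7 : ‖l‖ ^ 2 ≤ 2 * (1 / L) * ‖l‖ := by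
      rw [sq]; gcongr; linarith
    have h8 : (2 * q + 24 / L + 32 * q * L ^ 4) * ‖l‖ ≤ δ * ‖l‖ := by gcongr
    have h9 : 24 / L = 24 * (1 / L) := by ring
    rw [h9] at h8
    nlinarith
  -- The zero is found on the negative real axis, between `-1 / L` and `-1 / L²`.
  have hneg : ∀ s : ℝ, 0 < s → (1 / L) ^ 2 / 2 ≤ s → s ≤ 3 / 2 * (1 / L) →
      |(θ (-s : ℝ)).re - (c - s)| ≤ δ * s := by
    intro s hs h1 h2
    have hn : ‖((-s : ℝ) : ℂ)‖ = s := by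
      rw [Complex.norm_real, norm_neg, Real.norm_of_nonneg hs.le]
    have h3 := (hreg (-s : ℝ) (by rw [hn]; exact h1) (by rw [hn]; exact h2)).2
    rw [hn] at h3
    have h4 := (Complex.abs_re_le_norm _).trans h3
    simpa [sub_eq_add_neg] using h4
  have hcont : ContinuousOn (fun s : ℝ => (θ (-s : ℝ)).re) (Set.Icc ((1 / L) ^ 2) (1 / L)) := by
    intro s hs
    have hs0 : 0 < s := lt_of_lt_of_le (by positivity) hs.1
    have hn : ‖((-s : ℝ) : ℂ)‖ = s := by
      rw [Complex.norm_real, norm_neg, Real.norm_of_nonneg hs0.le]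
    have h1 := (hreg (-s : ℝ) (by rw [hn]; linarith [hs.1])
      (by rw [hn]; linarith [hs.2])).1.continuousAt
    have h2 : ContinuousAt (fun s : ℝ => ((-s : ℝ) : ℂ)) s := by fun_prop
    exact (Complex.continuous_re.continuousAt.comp
      (ContinuousAt.comp (f := fun s : ℝ => ((-s : ℝ) : ℂ)) h1 h2)).continuousWithinAt
  obtain ⟨s, hs, hs0⟩ : ∃ s ∈ Set.Icc ((1 / L) ^ 2) (1 / L), (θ (-s : ℝ)).re = 0 := by
    refine intermediate_value_Icc' (by linarith) hcont ⟨?_, ?_⟩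
    · have h1 := (abs_le.1 (hneg (1 / L) hiL0 (by linarith) (by linarith))).2
      have h2 : δ * (1 / L) ≤ 1 / 3 * (1 / L) := by gcongr
      linarith
    · have h1 := (abs_le.1 (hneg ((1 / L) ^ 2) hsq0 (by linarith) (by linarith))).1
      have h2 : δ * (1 / L) ^ 2 ≤ 1 / 3 * (1 / L) ^ 2 := by gcongr
      linarith
  have hsL : (1 / L) ^ 2 ≤ s := hs.1
  have hspos : 0 < s := lt_of_lt_of_le (by positivity) hs.1
  have hsc : (1 - δ) * s ≤ c := by
    have h1 := (abs_le.1 (hneg s hspos (by linarith) (by linarith [hs.2]))).2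
    rw [hs0] at h1
    linarith
  set a := √s with ha
  have ha2 : a ^ 2 = s := Real.sq_sqrt hspos.le
  have ha0 : 0 < a := Real.sqrt_pos.2 hspos
  have hha : 1 / L ≤ a := Real.le_sqrt_of_sq_le hs.1
  -- For `1 / L ≤ |z| ≤ a`, the ball of radius `|z|² / 2` about `|z|²` lies in the region where `θ` is
  -- close to `c + l`.
  have hmem : ∀ z : ℂ, 1 / L ≤ ‖z‖ → ‖z‖ ≤ a → z ∈ annulus r := by
    intro z h1 h2
    refine ⟨?_, ?_⟩
    · refine lt_of_pow_lt_pow_left₀ 2 (norm_nonneg z) ?_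
      have : (1 / L) ^ 2 ≤ ‖z‖ ^ 2 := by gcongr
      linarith
    · refine h2.trans_lt ((Real.sqrt_lt' one_pos).2 ?_)
      linarith [hs.2]
  have hann : ∀ z : ℂ, 1 / L ≤ ‖z‖ → ‖z‖ ≤ a → z ∈ annulus r ∧
      bergmanMetricCoeff (annulus r) z ≤
        (1 + 100 * δ) / (1 - δ) ^ 2 * (c / (c + ‖z‖ ^ 2) ^ 2) := by
    intro z h1 h2
    refine ⟨hmem z h1 h2, ?_⟩
    have ht1 : (1 / L) ^ 2 ≤ ‖z‖ ^ 2 := by gcongr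
    have ht2 : ‖z‖ ^ 2 ≤ 1 / L := by
      have : ‖z‖ ^ 2 ≤ a ^ 2 := by gcongr
      linarith [hs.2]
    obtain ⟨t, ht⟩ : ∃ t, ‖z‖ ^ 2 = t := ⟨_, rfl⟩
    rw [ht] at ht1 ht2 ⊢
    have ht0 : 0 < t := lt_of_lt_of_le (by positivity) ht1
    have hball : ∀ l ∈ closedBall (t : ℂ) (t / 2),
        DifferentiableAt ℂ θ l ∧ ‖θ l - (c + l)‖ ≤ δ * ‖l‖ := by
      intro l hl
      have hnt : ‖(t : ℂ)‖ = t := by rw [Complex.norm_real, Real.norm_of_nonneg ht0.le]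
      rw [mem_closedBall_iff_norm] at hl
      have h3 := norm_sub_norm_le (t : ℂ) l
      have h4 := norm_sub_norm_le l (t : ℂ)
      rw [norm_sub_rev] at h3
      rw [hnt] at h3 h4
      exact hreg l (by linarith) (by linarith)
    have key := log_laplacian_le ht0 (by linarith) hδ0.le hδ
      (fun l hl => (hball l hl).1.differentiableWithinAt) fun l hl => (hball l hl).2
    rw [bergmanMetricCoeff_annulus hr hq12 ht (by linarith) (by linarith) hθ key.1]
    exact key.2
  have hna : ‖(a : ℂ)‖ = a := by rw [Complex.norm_real, Real.norm_of_nonneg ha0.le]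
  have hnna : ‖((-a : ℝ) : ℂ)‖ = a := by
    rw [Complex.norm_real, norm_neg, Real.norm_of_nonneg ha0.le]
  have hmem1 := hmem a (by rw [hna]; exact hha) hna.le
  have hmem2 := hmem (-a : ℝ) (by rw [hnna]; exact hha) hnna.le
  refine ⟨a, hmem1, hmem2, ?_, ?_⟩
  · have hprod : ((-a : ℝ) : ℂ) * (starRingEnd ℂ) (a : ℂ) = (-s : ℝ) := by
      rw [Complex.conj_ofReal, ← Complex.ofReal_mul, ← ha2]
      congr 1
      ring
    have hzero : θ (-s : ℝ) = 0 := Complex.ext hs0 (annulusTheta_ofReal_im q c (-s))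
    rw [bergmanKernel_annulus hr hq12 hmem2 hmem1, hprod, ← hθ, hzero, zero_div]
  · refine (bergmanDist_le_of_metric_le hiL0.le hha hc0
      (div_nonneg (by linarith) (sq_nonneg _)) hann).trans (ENNReal.ofReal_le_ofReal ?_)
    have hsqrt : a / √c ≤ √(1 / (1 - δ)) := by
      rw [ha, ← Real.sqrt_div hspos.le]
      refine Real.sqrt_le_sqrt ?_
      rw [div_le_div_iff₀ hc0 (by linarith)]
      linarith
    have hturn : π * (1 / L) / √c ≤ δ := by
      rw [div_le_iff₀ (Real.sqrt_pos.2 hc0)]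
      refine le_of_sq_le_sq ?_ (by positivity)
      rw [mul_pow δ, Real.sq_sqrt hc0.le]
      calc (π * (1 / L)) ^ 2 = 2 * π ^ 2 / L * c := by rw [hc]; field_simp
        _ ≤ δ ^ 2 * c := by gcongr
    have := Real.arctan_mono hsqrt
    gcongr

theorem theorem4 :
    (∀ ε : ℝ, 0 < ε → ∃ r₀ : ℝ, 0 < r₀ ∧ r₀ < 1 ∧ ∀ r : ℝ, 0 < r → r < r₀ →
      ∃ z₀ ∈ annulus r, ∃ z ∈ bergmanBall (annulus r) z₀ (π / 2 + ε),
        bergmanKernel (annulus r) z z₀ = 0) ∧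
    (∀ R : ℝ, π / 2 < R →
      ¬ ∀ Ω : TopologicalSpace.Opens ℂ, IsConnected (Ω : Set ℂ) →
        Bornology.IsBounded (Ω : Set ℂ) →
        ∀ z₀ ∈ Ω, ∀ z ∈ bergmanBall Ω z₀ R, bergmanKernel Ω z z₀ ≠ 0) := by
  have hmain : ∀ ε : ℝ, 0 < ε → ∃ r₀ : ℝ, 0 < r₀ ∧ r₀ < 1 ∧ ∀ r : ℝ, 0 < r → r < r₀ →
      ∃ z₀ ∈ annulus r, ∃ z ∈ bergmanBall (annulus r) z₀ (π / 2 + ε),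
        bergmanKernel (annulus r) z z₀ = 0 := by
    intro ε hε
    obtain ⟨δ, ⟨hδε, hδ⟩, hδ0⟩ : ∃ δ : ℝ, (√((1 + 100 * δ) / (1 - δ) ^ 2) *
        (2 * Real.arctan (√(1 / (1 - δ))) + δ) < π / 2 + ε ∧ δ < 1 / 3) ∧ 0 < δ :=
      ((((eventually_radius_bound hε).and (gt_mem_nhds (by norm_num))).filter_mono
        nhdsWithin_le_nhds).and (self_mem_nhdsWithin (s := Set.Ioi (0 : ℝ)))).exists
    have hlim : Tendsto (fun r : ℝ => -Real.log r) (𝓝[>] 0) atTop :=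
      tendsto_neg_atBot_atTop.comp Real.tendsto_log_nhdsGT_zero
    obtain ⟨r₀, hr₀, hsub⟩ := mem_nhdsGT_iff_exists_Ioo_subset.1
      (hlim.eventually (eventually_annulus_parameters hδ0))
    refine ⟨min r₀ (1 / 2), lt_min hr₀ (by norm_num),
      (min_le_right _ _).trans_lt (by norm_num), fun r hr hrr => ?_⟩
    obtain ⟨h1, h2, h3, h4⟩ := hsub ⟨hr, hrr.trans_le (min_le_left _ _)⟩
    have hexp : Real.exp (-(2 * -Real.log r)) = r ^ 2 := by
      rw [show -(2 * -Real.log r) = Real.log r + Real.log r by ring, Real.exp_add,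
        Real.exp_log hr, sq]
    rw [hexp, neg_sq] at h2
    rw [hexp, show (-Real.log r) ^ 4 = Real.log r ^ 4 by ring] at h3
    obtain ⟨a, ha, hna, hK, hdist⟩ := exists_zero_bergmanKernel_annulus hr hδ0 hδ h1 h2 h3 h4
    refine ⟨a, ha, (-a : ℝ), ⟨hna, hdist.trans_lt ?_⟩, hK⟩
    exact (ENNReal.ofReal_lt_ofReal_iff (by positivity)).2 hδε
  refine ⟨hmain, fun R hR h => ?_⟩
  obtain ⟨r₀, hr₀, hr₀1, hann⟩ := hmain (R - π / 2) (sub_pos.2 hR)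
  obtain ⟨z₀, hz₀, z, hz, hK⟩ := hann (r₀ / 2) (by positivity) (by linarith)
  rw [add_sub_cancel] at hz
  exact h (annulus (r₀ / 2)) (annulus_isConnected (by positivity) (by linarith))
    (annulus_isBounded _) z₀ hz₀ z hz hK
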